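/- Let $r\ge 1$ and $n\ge 8(r^2+r+4)$ be integers. For a finite simple graph $G$, let $\rho(G)$ denote the largest eigenvalue of its adjacency matrix. Let $B_{r+1}$ be the book graph consisting of $r+1$ triangles sharing one common edge; a graph is $B_{r+1}$-free if it has no (not necessarily induced) subgraph isomorphic to $B_{r+1}$. Let $K^{r,r}_{\lfloor (n-1)/2\rfloor,\lceil (n-1)/2\rceil}$ be the graph on $n$ vertices obtained from the complete bipartite graph $K_{\lfloor (n-1)/2\rfloor,\lceil (n-1)/2\rceil}$ by adding one new vertex adjacent to exactly $r$ vertices in each of the two parts. If $G$ is a non-bipartite $B_{r+1}$-free graph on $n$ vertices, then $$\rho(G)\le \rho\Big(K^{r,r}_{\lfloor (n-1)/2\rfloor,\lceil (n-1)/2\rceil}\Big),$$ with equality if and only if $G\cong K^{r,r}_{\lfloor (n-1)/2\rfloor,\lceil (n-1)/2\rceil}$. -/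

import Mathlib

namespace SimpleGraph

open Classical in
/-- The set of eigenvalues of the (real) adjacency matrix of a finite graph. -/
def adjEigenvalues {V : Type*} [Fintype V] (G : SimpleGraph V) : Set ℝ :=
  {μ | Module.End.HasEigenvalue (Matrix.toLin' (G.adjMatrix ℝ)) μ}

/-- The spectral radius `ρ(G)`: the largest eigenvalue of the adjacency matrix of `G`
(see `isGreatest_rho`). -/
noncomputable def rho {V : Type*} [Fintype V] (G : SimpleGraph V) : ℝ :=
  sSup G.adjEigenvalues

theorem isGreatest_rho {V : Type*} [Fintype V] [Nonempty V] (G : SimpleGraph V) :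
    IsGreatest G.adjEigenvalues G.rho := by
  classical
  have hA : (G.adjMatrix ℝ).IsHermitian := by
    rw [Matrix.IsHermitian, Matrix.conjTranspose_eq_transpose_of_trivial]
    exact G.isSymm_adjMatrix
  have hE : G.adjEigenvalues = Set.range hA.eigenvalues := by
    rw [← hA.spectrum_real_eq_range_eigenvalues, ← Matrix.spectrum_toLin']
    ext μ
    rw [← Module.End.hasEigenvalue_iff_mem_spectrum, adjEigenvalues]
    simp only [Set.mem_ofPred_eq]
  have hfin : G.adjEigenvalues.Finite := hE ▸ Set.finite_range _
  have hne : G.adjEigenvalues.Nonempty := hE ▸ Set.range_nonempty _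
  exact ⟨hne.csSup_mem hfin, fun _ h => le_csSup hfin.bddAbove h⟩

/-- The book graph `B_k`: `k` triangles sharing one common edge. The common edge joins the two
vertices of `Fin 2`, and each vertex of `Fin k` is joined to exactly these two. -/
def book (k : ℕ) : SimpleGraph (Fin 2 ⊕ Fin k) where
  Adj
    | .inl a, .inl b => a ≠ b
    | .inl _, .inr _ => True
    | .inr _, .inl _ => True
    | .inr _, .inr _ => False
  symm := ⟨by rintro (a | a) (b | b) h <;> first | trivial | exact Ne.symm h⟩
  loopless := ⟨by rintro (a | a) h <;> first | exact h | exact h rfl⟩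

/-- The graph `K_{s,t}^{p,q}`: the complete bipartite graph `K_{s,t}` together with a new vertex
`none`, adjacent to the first `p` vertices of the part of size `s` and the first `q` vertices of
the part of size `t` (so to exactly `p` and `q` vertices, if `p ≤ s` and `q ≤ t`). -/
def bipartiteAddVertex (s t p q : ℕ) : SimpleGraph (Option (Fin s ⊕ Fin t)) where
  Adj
    | some x, some y => (completeBipartiteGraph (Fin s) (Fin t)).Adj x y
    | none, some (.inl i) => i.val < p
    | some (.inl i), none => i.val < p
    | none, some (.inr j) => j.val < q
    | some (.inr j), none => j.val < q
    | none, none => False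
  symm := ⟨by
    rintro (_ | a | a) (_ | b | b) h <;> first | exact h | exact (completeBipartiteGraph _ _).adj_symm h⟩
  loopless := ⟨by
    rintro (_ | a) h
    · exact h
    · exact (completeBipartiteGraph _ _).loopless.irrefl a h⟩

end SimpleGraph

/-! Suppose `ρ(G)` is at least the spectral radius of the balanced graph; the aim is to show that
`G` is that graph. Both claims then follow. Since the balanced graph satisfies `ρ² >
⌊(n-1)/2⌋⌈(n-1)/2⌉`, this gives `4ρ(G)² > n² - 2n`.

Take a nonnegative eigenvector `x` with maximum `x u = 1`, let `B = N(u)` and let `A` be its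
complement. Book-freeness enters only through its consequence that adjacent vertices have at most
`r` common neighbours. Counting weighted walks of length two from `u` shows that few pairs between
`A` and `B` are nonadjacent. The ends of an edge inside a part together miss nearly the whole other
part. So there is no room for edges inside both parts, two disjoint edges in one part, or a
triangle. The inner edges therefore form a star, and deleting its centre `v` leaves a bipartite
graph with parts `S`, `T` (`exists_almost_bipartition`).

Next, surplus edges from `v` to `S` are moved to a neighbour `t₀ ∈ T` of `v`, and surplus edges from
`v` to `T` to some `s₀ ∈ S`; missing edges are then added. As `x v` does not exceed the weights of
the recipients whenever edges are moved, the quadratic form at `x` does not drop, and the result is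
a cone graph `K_{S,T}^{r,r}` (`exists_coneGraph_quadratic_le`). Its radius is governed by an
equation involving only `|S||T|` and `|S| + |T|`, so the balanced case wins strictly (`rho_lt_rho`).
If all radii agree, `x` is a positive eigenvector of the cone graph too, and any change of `G` would
strictly enlarge some row sum. -/

namespace SimpleGraph

open scoped Classical

/-! ### Rayleigh quotients and the spectral radius. -/

section Spectral

variable {V W : Type*} [Fintype V] [Fintype W]

lemma toLin'_adjMatrix_apply (G : SimpleGraph V) (x : V → ℝ) (w : V) :
    Matrix.toLin' (G.adjMatrix ℝ) x w = ∑ z with G.Adj w z, x z := by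
  rw [Matrix.toLin'_apply, adjMatrix_mulVec_apply, neighborFinset_eq_filter]

lemma mem_adjEigenvalues_iff (G : SimpleGraph V) (μ : ℝ) :
    μ ∈ G.adjEigenvalues ↔ ∃ x : V → ℝ, x ≠ 0 ∧ ∀ w, ∑ z with G.Adj w z, x z = μ * x w := by
  have key : ∀ x : V → ℝ, Matrix.toLin' (G.adjMatrix ℝ) x = μ • x ↔
      ∀ w, ∑ z with G.Adj w z, x z = μ * x w := fun x => by
    rw [funext_iff]
    simp only [toLin'_adjMatrix_apply, Pi.smul_apply, smul_eq_mul]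
  constructor
  · intro h
    obtain ⟨x, hx⟩ := Module.End.HasEigenvalue.exists_hasEigenvector h
    exact ⟨x, hx.2, (key x).1 hx.apply_eq_smul⟩
  · rintro ⟨x, hx0, hx⟩
    exact Module.End.hasEigenvalue_of_hasEigenvector
      (Module.End.hasEigenvector_iff.2 ⟨Module.End.mem_eigenspace_iff.2 ((key x).2 hx), hx0⟩)

lemma adjEigenvalues_subset_of_iso {G : SimpleGraph V} {H : SimpleGraph W} (e : G ≃g H) :
    G.adjEigenvalues ⊆ H.adjEigenvalues := by
  intro μ hμ
  obtain ⟨x, hx0, hx⟩ := (mem_adjEigenvalues_iff G μ).1 hμ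
  refine (mem_adjEigenvalues_iff H μ).2 ⟨x ∘ e.symm, ?_, fun w => ?_⟩
  · intro h
    apply hx0
    ext v
    simpa using congrFun h (e v)
  · rw [Function.comp_apply, ← hx, Finset.sum_filter, Finset.sum_filter,
      ← Equiv.sum_comp e.toEquiv]
    refine Finset.sum_congr rfl fun z _ => ?_
    have : H.Adj w (e z) ↔ G.Adj (e.symm w) z := by
      rw [← e.map_adj_iff]; simp
    simp [this]

lemma rho_congr {G : SimpleGraph V} {H : SimpleGraph W} (e : G ≃g H) : G.rho = H.rho := by
  rw [rho, rho, (adjEigenvalues_subset_of_iso e).antisymm (adjEigenvalues_subset_of_iso e.symm)]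

lemma dotProduct_rho_sub_adjMatrix (G : SimpleGraph V) (x : V → ℝ) :
    star x ⬝ᵥ ((G.rho • (1 : Matrix V V ℝ) - G.adjMatrix ℝ).mulVec x) =
      G.rho * ∑ w, x w ^ 2 - ∑ w, x w * ∑ z with G.Adj w z, x z := by
  rw [Matrix.sub_mulVec, Matrix.smul_mulVec, Matrix.one_mulVec, dotProduct_sub,
    dotProduct_smul, dotProduct, dotProduct]
  simp only [adjMatrix_mulVec_apply, neighborFinset_eq_filter, star_trivial, smul_eq_mul, sq]

variable [Nonempty V]

lemma posSemidef_rho_sub_adjMatrix (G : SimpleGraph V) :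
    (G.rho • (1 : Matrix V V ℝ) - G.adjMatrix ℝ).PosSemidef := by
  have hA : (G.adjMatrix ℝ).IsHermitian := by
    rw [Matrix.IsHermitian, Matrix.conjTranspose_eq_transpose_of_trivial]
    exact G.isSymm_adjMatrix
  have hH : (G.rho • (1 : Matrix V V ℝ) - G.adjMatrix ℝ).IsHermitian := by
    refine Matrix.IsHermitian.sub ?_ hA
    rw [Matrix.IsHermitian, Matrix.conjTranspose_smul, Matrix.conjTranspose_one]
    simp
  rw [hH.posSemidef_iff_eigenvalues_nonneg]
  intro i
  have hv := hH.mulVec_eigenvectorBasis i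
  set v : V → ℝ := ⇑(hH.eigenvectorBasis i) with hvdef
  have hv0 : v ≠ 0 := by
    intro h
    apply hH.eigenvectorBasis.orthonormal.ne_zero i
    ext j
    exact congrFun h j
  have hmem : G.rho - hH.eigenvalues i ∈ G.adjEigenvalues := by
    refine (mem_adjEigenvalues_iff G _).2 ⟨v, hv0, fun w => ?_⟩
    have := congrFun hv w
    rw [Matrix.sub_mulVec, Matrix.smul_mulVec, Matrix.one_mulVec, Pi.sub_apply,
      adjMatrix_mulVec_apply, neighborFinset_eq_filter] at this
    simp only [Pi.smul_apply, smul_eq_mul] at this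
    linarith
  have := G.isGreatest_rho.2 hmem
  simp only [Pi.zero_apply]
  linarith

lemma sum_mul_sum_adj_le_rho (G : SimpleGraph V) (x : V → ℝ) :
    ∑ w, x w * ∑ z with G.Adj w z, x z ≤ G.rho * ∑ w, x w ^ 2 := by
  have := G.posSemidef_rho_sub_adjMatrix.dotProduct_mulVec_nonneg x
  rw [dotProduct_rho_sub_adjMatrix] at this
  linarith

/-- Equality case of the Rayleigh bound: a vector on which the positive semidefinite form of `ρ - A`
vanishes lies in its kernel. -/
lemma sum_adj_eq_of_rho_le (G : SimpleGraph V) (x : V → ℝ)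
    (h : G.rho * ∑ w, x w ^ 2 ≤ ∑ w, x w * ∑ z with G.Adj w z, x z) (w : V) :
    ∑ z with G.Adj w z, x z = G.rho * x w := by
  have h0 := (G.posSemidef_rho_sub_adjMatrix.dotProduct_mulVec_zero_iff x).1 (by
    rw [dotProduct_rho_sub_adjMatrix]
    linarith [G.sum_mul_sum_adj_le_rho x])
  have := congrFun h0 w
  rw [Matrix.sub_mulVec, Matrix.smul_mulVec, Matrix.one_mulVec, Pi.sub_apply,
      adjMatrix_mulVec_apply, neighborFinset_eq_filter] at this
  simp only [Pi.smul_apply, smul_eq_mul, Pi.zero_apply] at this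
  linarith

/-- A nonnegative eigenvector for the spectral radius, with maximal entry `1`. -/
lemma exists_nonneg_eigenvector (G : SimpleGraph V) :
    ∃ (x : V → ℝ) (u : V), (∀ w, 0 ≤ x w) ∧ x u = 1 ∧ (∀ w, x w ≤ 1) ∧
      ∀ w, ∑ z with G.Adj w z, x z = G.rho * x w := by
  obtain ⟨y, hy0, hy⟩ := (mem_adjEigenvalues_iff G _).1 G.isGreatest_rho.1
  -- Taking absolute values keeps the norm and does not decrease the form, so `|y|` still attains
  -- the maximum.
  have habs : ∀ w, ∑ z with G.Adj w z, |y z| = G.rho * |y w| := by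
    refine G.sum_adj_eq_of_rho_le (fun w => |y w|) ?_
    calc G.rho * ∑ w, |y w| ^ 2 = ∑ w, y w * ∑ z with G.Adj w z, y z := by
          rw [Finset.mul_sum]
          refine Finset.sum_congr rfl fun w _ => ?_
          rw [hy, sq_abs]; ring
      _ ≤ _ := by
          refine Finset.sum_le_sum fun w _ => ?_
          calc y w * ∑ z with G.Adj w z, y z ≤ |y w * ∑ z with G.Adj w z, y z| := le_abs_self _
            _ = |y w| * |∑ z with G.Adj w z, y z| := abs_mul _ _
            _ ≤ _ := by gcongr; exact Finset.abs_sum_le_sum_abs _ _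
  obtain ⟨u, -, hu⟩ := Finset.exists_max_image Finset.univ (fun w => |y w|) Finset.univ_nonempty
  have hpos : 0 < |y u| := by
    obtain ⟨w, hw⟩ := Function.ne_iff.1 hy0
    exact (abs_pos.2 hw).trans_le (hu w (Finset.mem_univ _))
  refine ⟨fun w => |y w| / |y u|, u, fun w => by positivity, div_self hpos.ne',
    fun w => (div_le_one hpos).2 (hu w (Finset.mem_univ _)), fun w => ?_⟩
  rw [← Finset.sum_div, habs, mul_div_assoc]

end Spectral

/-! ### The comparison graphs and the equation for their spectral radius. -/

section Cone

variable {V : Type*}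

/-- The complete bipartite graph between `S` and `T`, together with all edges from `v` to
`P ∪ Q`. -/
def coneGraph (v : V) (S T P Q : Finset V) : SimpleGraph V :=
  fromRel fun w z => w ∈ S ∧ z ∈ T ∨ w = v ∧ (z ∈ P ∨ z ∈ Q)

/-- The vertex `v` and the sets `S`, `T` partition the vertices, and `P ⊆ S` and `Q ⊆ T` have
`r` elements. -/
structure IsConeData (r : ℕ) (v : V) (S T P Q : Finset V) : Prop where
  disj : Disjoint S T
  notMem_left : v ∉ S
  notMem_right : v ∉ T
  cover : ∀ w, w = v ∨ w ∈ S ∨ w ∈ T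
  left_subset : P ⊆ S
  right_subset : Q ⊆ T
  card_left : P.card = r
  card_right : Q.card = r

namespace IsConeData

variable {r : ℕ} {v : V} {S T P Q : Finset V}

lemma symm (h : IsConeData r v S T P Q) : IsConeData r v T S Q P :=
  ⟨h.disj.symm, h.notMem_right, h.notMem_left, fun w => (h.cover w).imp_right Or.symm,
    h.right_subset, h.left_subset, h.card_right, h.card_left⟩

lemma coneGraph_comm (v : V) (S T P Q : Finset V) :
    coneGraph v T S Q P = coneGraph v S T P Q := by
  ext w z
  simp only [coneGraph, fromRel_adj]
  tauto

lemma card_add_card [Fintype V] (h : IsConeData r v S T P Q) : S.card + T.card + 1 = Fintype.card V := by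
  rw [← Finset.card_union_of_disjoint h.disj, ← Finset.card_insert_of_notMem (a := v),
    ← Finset.card_univ]
  · congr 1
    ext w
    simpa using h.cover w
  · simp [h.notMem_left, h.notMem_right]

lemma adj_apex (h : IsConeData r v S T P Q) (z : V) :
    (coneGraph v S T P Q).Adj v z ↔ z ∈ P ∨ z ∈ Q := by
  have h1 := h.notMem_left
  have h2 := h.notMem_right
  have h3 := @h.left_subset v
  have h4 := @h.right_subset v
  simp only [coneGraph, fromRel_adj]
  constructor
  · rintro ⟨hne, h | h⟩ <;> tauto
  · intro hz
    exact ⟨by rintro rfl; tauto, by tauto⟩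

lemma adj_left (h : IsConeData r v S T P Q) {w : V} (hw : w ∈ S) (z : V) :
    (coneGraph v S T P Q).Adj w z ↔ z ∈ T ∨ z = v ∧ w ∈ P := by
  have h1 := h.notMem_left
  have hwT := Finset.disjoint_left.1 h.disj hw
  have hQ := @h.right_subset w
  have hne : w ≠ v := by rintro rfl; exact h1 hw
  simp only [coneGraph, fromRel_adj]
  constructor
  · rintro ⟨hne, h | h⟩ <;> tauto
  · intro hz
    refine ⟨?_, by tauto⟩
    rintro rfl
    tauto

lemma adj_right (h : IsConeData r v S T P Q) {w : V} (hw : w ∈ T) (z : V) :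
    (coneGraph v S T P Q).Adj w z ↔ z ∈ S ∨ z = v ∧ w ∈ Q := by
  rw [← coneGraph_comm]
  exact h.symm.adj_left hw z

lemma nonempty_iso (h : IsConeData r v S T P Q) :
    Nonempty (coneGraph v S T P Q ≃g bipartiteAddVertex S.card T.card r r) := by
  have key : ∀ (S P : Finset V), P ⊆ S → P.card = r →
      ∃ e : S ≃ Fin S.card, ∀ w, (e w : ℕ) < r ↔ (w : V) ∈ P := by
    intro S P hPS hP
    have hle : r ≤ S.card := hP ▸ Finset.card_le_card hPS
    have hcard : Fintype.card {w : S // (w : V) ∈ P} =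
        Fintype.card {i : Fin S.card // (i : ℕ) < r} := by
      rw [Fintype.card_subtype, Fintype.card_subtype]
      have h1 : (Finset.univ.filter fun w : S => (w : V) ∈ P).card = P.card := by
        rw [← Finset.card_map (Function.Embedding.subtype _)]
        congr 1
        ext w
        simpa using @hPS w
      have h2 : (Finset.univ.filter fun i : Fin S.card => (i : ℕ) < r).card = r := by
        rw [← Fintype.card_subtype]
        have e : {i : Fin S.card // (i : ℕ) < r} ≃ Fin r :=
          ⟨fun i => ⟨i.1, i.2⟩, fun i => ⟨⟨i, i.2.trans_le hle⟩, i.2⟩, fun _ => rfl, fun _ => rfl⟩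
        rw [Fintype.card_congr e, Fintype.card_fin]
      rw [h1, h2, hP]
    let e0 : S ≃ Fin S.card := S.equivFin
    let e1 := Fintype.equivOfCardEq hcard
    have hcompl : Fintype.card {w : S // ¬ (w : V) ∈ P} =
        Fintype.card {i : Fin S.card // ¬ (i : ℕ) < r} := by
      rw [Fintype.card_subtype_compl, Fintype.card_subtype_compl, hcard]
      simp
    let e2 := Fintype.equivOfCardEq hcompl
    refine ⟨(Equiv.sumCompl _).symm.trans ((Equiv.sumCongr e1 e2).trans (Equiv.sumCompl _)),
      fun w => ?_⟩
    by_cases hw : (w : V) ∈ P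
    · have h1 : (Equiv.sumCompl fun w : S => (w : V) ∈ P).symm w = Sum.inl ⟨w, hw⟩ := by
        rw [Equiv.symm_apply_eq]; rfl
      simp only [hw, iff_true, Equiv.trans_apply, h1]
      exact (e1 ⟨w, hw⟩).2
    · have h1 : (Equiv.sumCompl fun w : S => (w : V) ∈ P).symm w = Sum.inr ⟨w, hw⟩ := by
        rw [Equiv.symm_apply_eq]; rfl
      simp only [hw, iff_false, Equiv.trans_apply, h1]
      exact (e2 ⟨w, hw⟩).2
  obtain ⟨e, he⟩ := key S P h.left_subset h.card_left
  obtain ⟨f, hf⟩ := key T Q h.right_subset h.card_right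
  let g : Option (Fin S.card ⊕ Fin T.card) → V := fun w => match w with
    | none => v
    | some (.inl i) => e.symm i
    | some (.inr j) => f.symm j
  have hS : ∀ i, (e.symm i : V) ∈ S := fun i => (e.symm i).2
  have hT : ∀ i, (f.symm i : V) ∈ T := fun i => (f.symm i).2
  have hg : Function.Bijective g := by
    constructor
    · rintro (_ | i | i) (_ | j | j) hij
      · rfl
      · have : v = e.symm j := hij
        exact absurd (this ▸ hS j) h.notMem_left
      · have : v = f.symm j := hij
        exact absurd (this ▸ hT j) h.notMem_right
      · have : e.symm i = v := hij
        exact absurd (this ▸ hS i) h.notMem_left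
      · have : e.symm i = e.symm j := Subtype.ext hij
        rw [e.symm.injective this]
      · have : (e.symm i : V) = f.symm j := hij
        exact absurd (this ▸ hT j) (Finset.disjoint_left.1 h.disj (hS i))
      · have : f.symm i = v := hij
        exact absurd (this ▸ hT i) h.notMem_right
      · have : (f.symm i : V) = e.symm j := hij
        exact absurd (this ▸ hT i) (Finset.disjoint_left.1 h.disj (hS j))
      · have : f.symm i = f.symm j := Subtype.ext hij
        rw [f.symm.injective this]
    · intro w
      rcases h.cover w with rfl | hw | hw
      · exact ⟨none, rfl⟩
      · exact ⟨some (.inl (e ⟨w, hw⟩)), by simp [g]⟩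
      · exact ⟨some (.inr (f ⟨w, hw⟩)), by simp [g]⟩
  have heP : ∀ i, (e.symm i : V) ∈ P ↔ (i : ℕ) < r := fun i => by rw [← he]; simp
  have hfQ : ∀ i, (f.symm i : V) ∈ Q ↔ (i : ℕ) < r := fun i => by rw [← hf]; simp
  have hPT : ∀ i, (e.symm i : V) ∉ T := fun i => Finset.disjoint_left.1 h.disj (hS i)
  have hQS : ∀ i, (f.symm i : V) ∉ S := fun i => Finset.disjoint_right.1 h.disj (hT i)
  have hPQ : ∀ i, (e.symm i : V) ∉ Q := fun i hi => hPT i (h.right_subset hi)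
  have hQP : ∀ i, (f.symm i : V) ∉ P := fun i hi => hQS i (h.left_subset hi)
  have hvP : v ∉ P := fun hi => h.notMem_left (h.left_subset hi)
  have hvQ : v ∉ Q := fun hi => h.notMem_right (h.right_subset hi)
  have hvS : ∀ i, (e.symm i : V) ≠ v := fun i hi => h.notMem_left (hi ▸ hS i)
  have hvT : ∀ i, (f.symm i : V) ≠ v := fun i hi => h.notMem_right (hi ▸ hT i)
  refine ⟨(RelIso.symm ⟨Equiv.ofBijective g hg, ?_⟩)⟩
  rintro (_ | i | i) (_ | j | j)
  · simp [g, bipartiteAddVertex]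
  · simp [g, h.adj_apex, heP, hPQ, bipartiteAddVertex]
  · simp [g, h.adj_apex, hfQ, hQP, bipartiteAddVertex]
  · simp [g, h.adj_left (hS i), heP, h.notMem_right, bipartiteAddVertex]
  · simp [g, h.adj_left (hS i), hPT, hvS, bipartiteAddVertex]
  · simp [g, h.adj_left (hS i), hT, bipartiteAddVertex]
  · simp [g, h.adj_right (hT i), hfQ, h.notMem_left, bipartiteAddVertex]
  · simp [g, h.adj_right (hT i), hS, bipartiteAddVertex]
  · simp [g, h.adj_right (hT i), hQS, hvT, bipartiteAddVertex]

variable [Fintype V]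

lemma sum_adj_apex (h : IsConeData r v S T P Q) (x : V → ℝ) :
    ∑ z with (coneGraph v S T P Q).Adj v z, x z = ∑ z ∈ P, x z + ∑ z ∈ Q, x z := by
  rw [← Finset.sum_union (h.disj.mono h.left_subset h.right_subset)]
  congr 1
  ext z
  simp [h.adj_apex]

lemma sum_adj_left (h : IsConeData r v S T P Q) (x : V → ℝ) {w : V} (hw : w ∈ S) :
    ∑ z with (coneGraph v S T P Q).Adj w z, x z =
      ∑ z ∈ T, x z + if w ∈ P then x v else 0 := by
  have : (Finset.univ.filter fun z => (coneGraph v S T P Q).Adj w z) =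
      T ∪ if w ∈ P then {v} else ∅ := by
    ext z
    split_ifs with hP <;> simp [h.adj_left hw, hP, or_comm]
  rw [this, Finset.sum_union]
  · split_ifs <;> simp
  · split_ifs <;> simp [h.notMem_right]

lemma sum_adj_right (h : IsConeData r v S T P Q) (x : V → ℝ) {w : V} (hw : w ∈ T) :
    ∑ z with (coneGraph v S T P Q).Adj w z, x z =
      ∑ z ∈ S, x z + if w ∈ Q then x v else 0 := by
  rw [← coneGraph_comm]
  exact h.symm.sum_adj_left x hw

variable {x : V → ℝ} {μ : ℝ}

lemma mul_sum_left (h : IsConeData r v S T P Q)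
    (hx : ∀ w, ∑ z with (coneGraph v S T P Q).Adj w z, x z = μ * x w) :
    μ * ∑ w ∈ S, x w = S.card * ∑ z ∈ T, x z + r * x v := by
  rw [Finset.mul_sum, Finset.sum_congr rfl fun w hw => (hx w).symm.trans (h.sum_adj_left x hw),
    Finset.sum_add_distrib, Finset.sum_const, nsmul_eq_mul, ← Finset.sum_filter,
    Finset.filter_mem_eq_inter, Finset.inter_eq_right.2 h.left_subset, Finset.sum_const,
    nsmul_eq_mul, h.card_left]

lemma mul_sum_left_nbrs (h : IsConeData r v S T P Q)
    (hx : ∀ w, ∑ z with (coneGraph v S T P Q).Adj w z, x z = μ * x w) :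
    μ * ∑ w ∈ P, x w = r * ∑ z ∈ T, x z + r * x v := by
  rw [Finset.mul_sum, Finset.sum_congr rfl fun w hw =>
      (hx w).symm.trans (h.sum_adj_left x (h.left_subset hw)),
    Finset.sum_add_distrib, Finset.sum_const, nsmul_eq_mul, ← Finset.sum_filter,
    Finset.filter_mem_eq_inter, Finset.inter_self, Finset.sum_const,
    nsmul_eq_mul, h.card_left]

/-- The positivity of a nonnegative eigenvector of the cone graph, and the equation satisfied by
its eigenvalue. -/
lemma eigenvalue_equation (h : IsConeData r v S T P Q) (hr : 1 ≤ r) (hμ : 0 < μ)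
    (hx : ∀ w, ∑ z with (coneGraph v S T P Q).Adj w z, x z = μ * x w)
    (hx0 : ∀ w, 0 ≤ x w) (hne : x ≠ 0) :
    (∀ w, 0 < x w) ∧ (S.card * T.card : ℝ) < μ ^ 2 ∧
      (μ ^ 2 - 2 * r) * (μ ^ 2 - S.card * T.card) = r ^ 2 * (2 * μ + (S.card + T.card)) := by
  have hcomm : ∀ w, ∑ z with (coneGraph v T S Q P).Adj w z, x z = μ * x w := by
    rw [coneGraph_comm]; exact hx
  have hr' : (1 : ℝ) ≤ r := by exact_mod_cast hr
  have e1 := h.mul_sum_left hx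
  have e2 := h.symm.mul_sum_left hcomm
  have e3 := h.mul_sum_left_nbrs hx
  have e4 := h.symm.mul_sum_left_nbrs hcomm
  have e5 := (hx v).symm.trans (h.sum_adj_apex x)
  have hσ0 : 0 ≤ ∑ w ∈ S, x w := Finset.sum_nonneg fun w _ => hx0 w
  have hτ0 : 0 ≤ ∑ w ∈ T, x w := Finset.sum_nonneg fun w _ => hx0 w
  set σ := ∑ w ∈ S, x w with hσ
  set τ := ∑ w ∈ T, x w with hτ
  set s : ℝ := (S.card : ℝ)
  set t : ℝ := (T.card : ℝ)
  have hs : 0 ≤ s := Nat.cast_nonneg _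
  have ht : 0 ≤ t := Nat.cast_nonneg _
  have e6 : μ ^ 2 * x v = r * (σ + τ) + 2 * r * x v := by
    linear_combination μ * e5 + e3 + e4
  have hv : 0 < x v := by
    refine (hx0 v).lt_of_ne fun hv => hne ?_
    rw [← hv] at e6
    have hsum : σ + τ = 0 := by
      have : (r : ℝ) * (σ + τ) = 0 := by linarith
      rcases mul_eq_zero.1 this with h | h
      · linarith
      · exact h
    have hσ1 : σ = 0 := by linarith
    have hτ1 : τ = 0 := by linarith
    ext w
    rcases h.cover w with rfl | hw | hw
    · exact hv.symm
    · exact (Finset.sum_eq_zero_iff_of_nonneg fun w _ => hx0 w).1 hσ1 w hw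
    · exact (Finset.sum_eq_zero_iff_of_nonneg fun w _ => hx0 w).1 hτ1 w hw
  have hrv : 0 < r * x v := by positivity
  have hσp : 0 < σ := by
    have : 0 < μ * σ := by rw [e1]; positivity
    exact pos_of_mul_pos_right this hμ.le
  have hτp : 0 < τ := by
    have : 0 < μ * τ := by rw [e2]; positivity
    exact pos_of_mul_pos_right this hμ.le
  -- Solving the system `μσ = sτ + r x_v`, `μτ = tσ + r x_v`. Substitution into `e6` and cancelling
  -- `x v` gives the equation in `μ`, which depends on the sizes only through `st` and `s + t`.
  have e7 : (μ ^ 2 - s * t) * σ = r * (s + μ) * x v := by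
    linear_combination μ * e1 + s * e2
  have e8 : (μ ^ 2 - s * t) * τ = r * (t + μ) * x v := by
    linear_combination μ * e2 + t * e1
  refine ⟨fun w => ?_, ?_, ?_⟩
  · rcases h.cover w with rfl | hw | hw
    · exact hv
    · have := (hx w).symm.trans (h.sum_adj_left x hw)
      have : 0 < μ * x w := by
        rw [this]; split_ifs <;> linarith
      exact pos_of_mul_pos_right this hμ.le
    · have := (hx w).symm.trans (h.sum_adj_right x hw)
      have : 0 < μ * x w := by
        rw [this]; split_ifs <;> linarith
      exact pos_of_mul_pos_right this hμ.le
  · have : 0 < (μ ^ 2 - s * t) * σ := by rw [e7]; positivity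
    have := pos_of_mul_pos_left this hσp.le
    linarith
  · refine mul_right_cancel₀ hv.ne' ?_
    linear_combination (μ ^ 2 - s * t) * e6 + r * e7 + r * e8

/-- Test vector: the indicator of the two ends of one edge at the apex. -/
lemma rho_pos (h : IsConeData r v S T P Q) (hr : 1 ≤ r) : 0 < (coneGraph v S T P Q).rho := by
  have : Nonempty V := ⟨v⟩
  obtain ⟨x, u, hx0, hu, hx1, hx⟩ := (coneGraph v S T P Q).exists_nonneg_eigenvector
  obtain ⟨p, hp⟩ : P.Nonempty := by rw [← Finset.card_pos, h.card_left]; omega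
  set y : V → ℝ := fun w => if w = v ∨ w = p then 1 else 0 with hy
  have hvp : p ≠ v := by rintro rfl; exact h.notMem_left (h.left_subset hp)
  have hadj : (coneGraph v S T P Q).Adj v p := (h.adj_apex p).2 (Or.inl hp)
  have hle := (coneGraph v S T P Q).sum_mul_sum_adj_le_rho y
  have hy0 : ∀ w, 0 ≤ y w := fun w => by simp only [hy]; split_ifs <;> norm_num
  have hpos : 0 < ∑ w, y w * ∑ z with (coneGraph v S T P Q).Adj w z, y z := by
    refine Finset.sum_pos' (fun w _ => mul_nonneg (hy0 w) (Finset.sum_nonneg fun z _ => hy0 z))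
      ⟨v, Finset.mem_univ _, mul_pos (by simp [hy]) ?_⟩
    exact Finset.sum_pos' (fun z _ => hy0 z) ⟨p, by simpa using hadj, by simp [hy]⟩
  exact pos_of_mul_pos_left (hpos.trans_le hle) (Finset.sum_nonneg fun w _ => sq_nonneg _)

lemma rho_equation (h : IsConeData r v S T P Q) (hr : 1 ≤ r) :
    (S.card * T.card : ℝ) < (coneGraph v S T P Q).rho ^ 2 ∧
      ((coneGraph v S T P Q).rho ^ 2 - 2 * r) *
        ((coneGraph v S T P Q).rho ^ 2 - S.card * T.card) =
        r ^ 2 * (2 * (coneGraph v S T P Q).rho + (S.card + T.card)) := by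
  have : Nonempty V := ⟨v⟩
  obtain ⟨x, u, hx0, hu, hx1, hx⟩ := (coneGraph v S T P Q).exists_nonneg_eigenvector
  exact (h.eigenvalue_equation hr (h.rho_pos hr) hx hx0 (fun h0 => by simp [h0] at hu)).2

/-- The spectral radius of the cone graph increases with the product of the sizes of the parts. -/
lemma rho_lt_rho (h : IsConeData r v S T P Q) (hr : 1 ≤ r)
    {v' : V} {S' T' P' Q' : Finset V} (h' : IsConeData r v' S' T' P' Q')
    (hlt : S.card * T.card < S'.card * T'.card) (h2r : 2 * r ≤ S'.card * T'.card) :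
    (coneGraph v S T P Q).rho < (coneGraph v' S' T' P' Q').rho := by
  by_contra! hle
  obtain ⟨a1, a2⟩ := h.rho_equation hr
  obtain ⟨b1, b2⟩ := h'.rho_equation hr
  have hm := h'.rho_pos hr
  have hsum : (S.card + T.card : ℝ) = S'.card + T'.card := by
    have := h.card_add_card.trans h'.card_add_card.symm
    norm_cast; omega
  rw [hsum] at a2
  set l := (coneGraph v S T P Q).rho
  set m := (coneGraph v' S' T' P' Q').rho
  have hr' : (1 : ℝ) ≤ r := by exact_mod_cast hr
  have hlt' : (S.card * T.card : ℝ) < S'.card * T'.card := by exact_mod_cast hlt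
  have h2r' : (2 * r : ℝ) ≤ S'.card * T'.card := by exact_mod_cast h2r
  set K : ℝ := S.card * T.card
  set K' : ℝ := S'.card * T'.card
  have hN : (0 : ℝ) ≤ S'.card + T'.card := by positivity
  set N : ℝ := S'.card + T'.card
  have hml : m ^ 2 ≤ l ^ 2 := pow_le_pow_left₀ hm.le hle 2
  -- With both sides of the equation divided by `μ`, the left side is increasing and the right side
  -- nonincreasing. Hence `m ≤ l` and equality at `m` force left ≥ right at `l`, whereas `K < K'`
  -- gives strict < there (`h3`). Here `l² > 2r` because `2r ≤ K' < m² ≤ l²`.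
  have h1 : m * (l ^ 2 - 2 * r) ≥ l * (m ^ 2 - 2 * r) := by
    nlinarith [mul_nonneg (mul_nonneg hm.le (hm.le.trans hle)) (sub_nonneg.2 hle),
      mul_nonneg (zero_le_one.trans hr') (sub_nonneg.2 hle)]
  have h3 : (l ^ 2 - 2 * r) * (l ^ 2 - K') < r ^ 2 * (2 * l + N) := by nlinarith
  have h4 : (m ^ 2 - 2 * r) * (m ^ 2 - K') * l ≤ (l ^ 2 - 2 * r) * (l ^ 2 - K') * m := by
    have : l * (m ^ 2 - 2 * r) * (m ^ 2 - K') ≤ m * (l ^ 2 - 2 * r) * (l ^ 2 - K') := by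
      apply mul_le_mul h1 <;> nlinarith
    linarith
  rw [b2] at h4
  have h5 : r ^ 2 * (2 * l + N) * m ≤ r ^ 2 * (2 * m + N) * l := by
    have : (r : ℝ) ^ 2 * N * m ≤ r ^ 2 * N * l := by gcongr
    linarith
  nlinarith

end IsConeData

/-- Realises the extremal graph on the vertex set of `G` itself. -/
lemma exists_isConeData [Fintype V] {r s t : ℕ} (hV : s + t + 1 = Fintype.card V) (hs : r ≤ s) (ht : r ≤ t) :
    ∃ (v : V) (S T P Q : Finset V), IsConeData r v S T P Q ∧ S.card = s ∧ T.card = t := by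
  obtain ⟨v⟩ : Nonempty V := Fintype.card_pos_iff.1 (by omega)
  have hc : (Finset.univ.erase v).card = s + t := by
    rw [Finset.card_erase_of_mem (Finset.mem_univ v), Finset.card_univ]; omega
  obtain ⟨S, hS, hSc⟩ := Finset.exists_subset_card_eq (s := Finset.univ.erase v) (n := s) (by omega)
  have hTc : ((Finset.univ.erase v) \ S).card = t := by
    rw [Finset.card_sdiff_of_subset hS]; omega
  obtain ⟨P, hP, hPc⟩ := Finset.exists_subset_card_eq (s := S) (n := r) (by omega)
  obtain ⟨Q, hQ, hQc⟩ := Finset.exists_subset_card_eq (s := (Finset.univ.erase v) \ S) (n := r)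
    (by omega)
  refine ⟨v, S, _, P, Q, ⟨Finset.disjoint_sdiff, fun h => by simpa using hS h, by simp,
    fun w => ?_, hP, hQ, hPc, hQc⟩, hSc, hTc⟩
  by_cases h1 : w = v <;> by_cases h2 : w ∈ S <;> simp [h1, h2]

end Cone

/-! ### Moving surplus edges of the apex. -/

section Switching

variable {V : Type*} [Fintype V]

/-- The set of neighbours of `v` in `S` that are kept when the surplus ones are handed over to
`t₀`. -/
lemma exists_kept_nbrs {r : ℕ} (hr : 1 ≤ r) (G : SimpleGraph V) {v s₀ t₀ : V} {S : Finset V}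
    (hS : r ≤ S.card) (hs₀ : s₀ ∈ S) (hvs : G.Adj v s₀)
    (hcod : (Finset.univ.filter fun y => G.Adj v y ∧ G.Adj t₀ y).card ≤ r)
    (hst : G.Adj t₀ s₀ ∨ ∀ s ∈ S, G.Adj v s → ¬ G.Adj t₀ s) :
    ∃ P ⊆ S, P.card = r ∧ ((∀ s ∈ S, G.Adj v s → s ∈ P) ∨
      s₀ ∈ P ∧ (∀ s ∈ P, G.Adj v s) ∧ (∀ s ∈ S, G.Adj v s → s ∉ P → ¬ G.Adj t₀ s) ∧
        r < (S.filter (G.Adj v)).card) := by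
  rcases le_or_gt (S.filter (G.Adj v)).card r with h | h
  · obtain ⟨P, h1, h2, h3⟩ := Finset.exists_subsuperset_card_eq (Finset.filter_subset (G.Adj v) S)
      h hS
    exact ⟨P, h2, h3, Or.inl fun s hs hvs => h1 (by simp [hs, hvs])⟩
  -- The kept set must contain `s₀` and every common neighbour of `v` and `t₀`, so that each edge
  -- moved to `t₀` is new. This fits into `r` elements: either `s₀` is itself such a common
  -- neighbour, or there are none in `S`.
  · have hC : insert s₀ (S.filter fun s => G.Adj v s ∧ G.Adj t₀ s) ⊆ S.filter (G.Adj v) := by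
      intro s hs
      rcases Finset.mem_insert.1 hs with rfl | hs
      · simp [hs₀, hvs]
      · simp only [Finset.mem_filter] at hs ⊢
        tauto
    have hcard : (insert s₀ (S.filter fun s => G.Adj v s ∧ G.Adj t₀ s)).card ≤ r := by
      rcases hst with hst | hst
      · rw [Finset.insert_eq_of_mem (by simp [hs₀, hvs, hst])]
        exact (Finset.card_le_card (Finset.filter_subset_filter _ (Finset.subset_univ _))).trans hcod
      · rw [Finset.filter_false_of_mem fun s hs h => hst s hs h.1 h.2]
        simpa using hr
    obtain ⟨P, h1, h2, h3⟩ := Finset.exists_subsuperset_card_eq hC hcard h.le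
    refine ⟨P, h2.trans (Finset.filter_subset _ _), h3, Or.inr ⟨h1 (by simp), fun s hs => ?_,
      fun s hs hvs hsP ht => hsP (h1 (by simp [hs, hvs, ht])), h⟩⟩
    exact (Finset.mem_filter.1 (h2 hs)).2

/-- The change of the quadratic form when the edges from `v` to `R` are replaced by edges from `t`
to `R`. -/
lemma sum_switch (x : V → ℝ) (R : Finset V) (t v : V) :
    ∑ w, ∑ z, (((if w = t then (1 : ℝ) else 0) - if w = v then 1 else 0) *
        (if z ∈ R then 1 else 0) + (if w ∈ R then 1 else 0) *
        ((if z = t then (1 : ℝ) else 0) - if z = v then 1 else 0)) * (x w * x z) =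
      2 * (x t - x v) * ∑ z ∈ R, x z := by
  have h1 : ∑ w, ((if w = t then (1 : ℝ) else 0) - if w = v then 1 else 0) * x w = x t - x v := by
    simp [sub_mul, Finset.sum_sub_distrib]
  have h2 : ∑ z, (if z ∈ R then (1 : ℝ) else 0) * x z = ∑ z ∈ R, x z := by
    simp
  calc _ = (∑ w, ((if w = t then (1 : ℝ) else 0) - if w = v then 1 else 0) * x w) *
        (∑ z, (if z ∈ R then (1 : ℝ) else 0) * x z) +
        (∑ z, (if z ∈ R then (1 : ℝ) else 0) * x z) *
        (∑ w, ((if w = t then (1 : ℝ) else 0) - if w = v then 1 else 0) * x w) := by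
        rw [Finset.sum_mul_sum, Finset.sum_mul_sum, ← Finset.sum_add_distrib]
        refine Finset.sum_congr rfl fun w _ => ?_
        rw [← Finset.sum_add_distrib]
        exact Finset.sum_congr rfl fun z _ => by ring
    _ = _ := by rw [h1, h2]; ring

lemma sum_mul_sum_adj_eq (G : SimpleGraph V) (x : V → ℝ) :
    ∑ w, x w * ∑ z with G.Adj w z, x z =
      ∑ w, ∑ z, (if G.Adj w z then (1 : ℝ) else 0) * (x w * x z) := by
  refine Finset.sum_congr rfl fun w _ => ?_
  rw [Finset.sum_filter, Finset.mul_sum]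
  exact Finset.sum_congr rfl fun z _ => by split_ifs <;> ring

/-- If deleting `v` from `G` leaves a bipartite graph, then `G` can be turned into a cone graph
without decreasing the quadratic form at `x`. -/
lemma exists_coneGraph_quadratic_le {r : ℕ} (hr : 1 ≤ r) (G : SimpleGraph V) {v : V}
    {S T : Finset V} (hdisj : Disjoint S T) (hvS : v ∉ S) (hvT : v ∉ T)
    (hcover : ∀ w, w = v ∨ w ∈ S ∨ w ∈ T) (hSr : r ≤ S.card) (hTr : r ≤ T.card)
    (hSS : ∀ w ∈ S, ∀ z ∈ S, ¬ G.Adj w z) (hTT : ∀ w ∈ T, ∀ z ∈ T, ¬ G.Adj w z)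
    (hcod : ∀ w z, G.Adj w z → (Finset.univ.filter fun y => G.Adj w y ∧ G.Adj z y).card ≤ r)
    (hnS : ∃ s ∈ S, G.Adj v s) (hnT : ∃ t ∈ T, G.Adj v t)
    {x : V → ℝ} (hx0 : ∀ w, 0 ≤ x w) (hxS : ∀ s ∈ S, G.Adj v s → x v ≤ x s)
    (hxT : r < (S.filter (G.Adj v)).card → ∀ t ∈ T, G.Adj v t → x v ≤ x t) :
    ∃ P Q, IsConeData r v S T P Q ∧
      ∑ w, x w * ∑ z with G.Adj w z, x z ≤
        ∑ w, x w * ∑ z with (coneGraph v S T P Q).Adj w z, x z ∧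
      (G ≠ coneGraph v S T P Q → ∃ w, (∀ z, G.Adj w z → (coneGraph v S T P Q).Adj w z) ∧
        ∃ z, (coneGraph v S T P Q).Adj w z ∧ ¬ G.Adj w z) := by
  -- The recipients are chosen to form a triangle with `v` if any exists; otherwise there is nothing
  -- for a moved edge to collide with.
  obtain ⟨s₀, hs₀, hvs, t₀, ht₀, hvt, hst⟩ : ∃ s₀ ∈ S, G.Adj v s₀ ∧ ∃ t₀ ∈ T, G.Adj v t₀ ∧
      (G.Adj s₀ t₀ ∨ ∀ s ∈ S, G.Adj v s → ∀ t ∈ T, G.Adj v t → ¬ G.Adj s t) := by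
    by_cases h : ∃ s ∈ S, G.Adj v s ∧ ∃ t ∈ T, G.Adj v t ∧ G.Adj s t
    · obtain ⟨s, hs, hvs, t, ht, hvt, hst⟩ := h
      exact ⟨s, hs, hvs, t, ht, hvt, Or.inl hst⟩
    · push Not at h
      obtain ⟨s, hs, hvs⟩ := hnS
      obtain ⟨t, ht, hvt⟩ := hnT
      exact ⟨s, hs, hvs, t, ht, hvt, Or.inr h⟩
  obtain ⟨P, hPS, hPc, hP⟩ := exists_kept_nbrs hr G hSr hs₀ hvs (hcod v t₀ hvt)
    (hst.imp (fun h => h.symm) fun h s hs hvs hts => h s hs hvs t₀ ht₀ hvt hts.symm)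
  obtain ⟨Q, hQT, hQc, hQ⟩ := exists_kept_nbrs hr G hTr ht₀ hvt (hcod v s₀ hvs)
    (hst.imp (fun h => h) fun h t ht hvt hts => h s₀ hs₀ hvs t ht hvt hts)
  have hc : IsConeData r v S T P Q := ⟨hdisj, hvS, hvT, hcover, hPS, hQT, hPc, hQc⟩
  have hST : ∀ {w}, w ∈ S → w ∉ T := fun h => Finset.disjoint_left.1 hdisj h
  have hTS : ∀ {w}, w ∈ T → w ∉ S := fun h => Finset.disjoint_right.1 hdisj h
  have hS₀P : (∃ s ∈ S, G.Adj v s ∧ s ∉ P) → s₀ ∈ P ∧ x v ≤ x t₀ := by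
    rintro ⟨s, hs, hvs, hsP⟩
    rcases hP with hP | hP
    · exact absurd (hP s hs hvs) hsP
    · exact ⟨hP.1, hxT hP.2.2.2 t₀ ht₀ hvt⟩
  have hnadjS : ∀ s ∈ S, G.Adj v s → s ∉ P → ¬ G.Adj t₀ s := by
    rcases hP with hP | hP
    · exact fun s hs hvs hsP => absurd (hP s hs hvs) hsP
    · exact hP.2.2.1
  have hnadjT : ∀ t ∈ T, G.Adj v t → t ∉ Q → ¬ G.Adj s₀ t := by
    rcases hQ with hQ | hQ
    · exact fun s hs hvs hsP => absurd (hQ s hs hvs) hsP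
    · exact hQ.2.2.1
  have hs₀P : s₀ ∈ P := by
    rcases hP with hP | hP
    · exact hP s₀ hs₀ hvs
    · exact hP.1
  have ht₀Q : t₀ ∈ Q := by
    rcases hQ with hQ | hQ
    · exact hQ t₀ ht₀ hvt
    · exact hQ.1
  set RS := S.filter fun s => G.Adj v s ∧ s ∉ P with hRS
  set RT := T.filter fun t => G.Adj v t ∧ t ∉ Q with hRT
  refine ⟨P, Q, hc, ?_, fun hne => ?_⟩
  -- Entrywise, the adjacency matrix after both switches is dominated by that of the cone graph. The
  -- two switches never create the same edge, because `s₀` and `t₀` are kept.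
  · have key : ∀ w z, (if G.Adj w z then (1 : ℝ) else 0) +
        (((if w = t₀ then (1 : ℝ) else 0) - if w = v then 1 else 0) *
          (if z ∈ RS then 1 else 0) + (if w ∈ RS then 1 else 0) *
          ((if z = t₀ then (1 : ℝ) else 0) - if z = v then 1 else 0)) +
        (((if w = s₀ then (1 : ℝ) else 0) - if w = v then 1 else 0) *
          (if z ∈ RT then 1 else 0) + (if w ∈ RT then 1 else 0) *
          ((if z = s₀ then (1 : ℝ) else 0) - if z = v then 1 else 0)) ≤
        if (coneGraph v S T P Q).Adj w z then 1 else 0 := by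
      have hvt₀ : v ≠ t₀ := hvt.ne
      have hvs₀ : v ≠ s₀ := hvs.ne
      have hnS : ∀ {s}, s ∈ S → s ≠ t₀ ∧ s ≠ v := fun h =>
        ⟨by rintro rfl; exact hTS ht₀ h, by rintro rfl; exact hvS h⟩
      have hnT : ∀ {s}, s ∈ T → s ≠ s₀ ∧ s ≠ v := fun h =>
        ⟨by rintro rfl; exact hST hs₀ h, by rintro rfl; exact hvT h⟩
      have hleft : ∀ {s}, s ∈ S → ∀ {t}, t ∈ T → (if G.Adj s t then (1 : ℝ) else 0) +
          (if s ∈ RS then 1 else 0) * (if t = t₀ then 1 else 0) +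
          (if t ∈ RT then 1 else 0) * (if s = s₀ then 1 else 0) ≤ 1 := by
        intro s hs t ht
        by_cases h1 : s ∈ RS ∧ t = t₀
        · obtain ⟨h1, rfl⟩ := h1
          have h2 := (Finset.mem_filter.1 h1).2
          have h3 : ¬ G.Adj s t := fun h => hnadjS s hs h2.1 h2.2 h.symm
          have h4 : t ∉ RT := by simp [hRT, ht₀Q]
          simp [h1, h3, h4]
        · by_cases h5 : t ∈ RT ∧ s = s₀
          · obtain ⟨h5, rfl⟩ := h5
            have h2 := (Finset.mem_filter.1 h5).2
            have h3 : ¬ G.Adj s t := fun h => hnadjT t ht h2.1 h2.2 h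
            have h4 : s ∉ RS := by simp [hRS, hs₀P]
            simp [h5, h3, h4]
          · have e1 : (if s ∈ RS then (1 : ℝ) else 0) * (if t = t₀ then 1 else 0) = 0 := by
              rw [ite_mul, one_mul, zero_mul, ← ite_and, if_neg h1]
            have e2 : (if t ∈ RT then (1 : ℝ) else 0) * (if s = s₀ then 1 else 0) = 0 := by
              rw [ite_mul, one_mul, zero_mul, ← ite_and, if_neg h5]
            rw [e1, e2]
            split_ifs <;> norm_num
      have hapS : ∀ {s}, s ∈ S → (if G.Adj v s then (1 : ℝ) else 0) -
          (if s ∈ RS then 1 else 0) ≤ if s ∈ P then 1 else 0 := by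
        intro s hs
        by_cases h1 : G.Adj v s <;> by_cases h2 : s ∈ P <;> simp [hRS, hs, h1, h2]
      have hapT : ∀ {s}, s ∈ T → (if G.Adj v s then (1 : ℝ) else 0) -
          (if s ∈ RT then 1 else 0) ≤ if s ∈ Q then 1 else 0 := by
        intro s hs
        by_cases h1 : G.Adj v s <;> by_cases h2 : s ∈ Q <;> simp [hRT, hs, h1, h2]
      have hSRT : ∀ {s}, s ∈ S → s ∉ RT ∧ s ∉ Q := fun h =>
        ⟨fun h' => hST h (Finset.mem_filter.1 h').1, fun h' => hST h (hQT h')⟩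
      have hTRS : ∀ {s}, s ∈ T → s ∉ RS ∧ s ∉ P := fun h =>
        ⟨fun h' => hTS h (Finset.mem_filter.1 h').1, fun h' => hTS h (hPS h')⟩
      have hvRS : v ∉ RS := fun h => hvS (Finset.mem_filter.1 h).1
      have hvRT : v ∉ RT := fun h => hvT (Finset.mem_filter.1 h).1
      intro w z
      rcases hcover w with rfl | hw | hw <;> rcases hcover z with rfl | hz | hz
      · simp [hvRS, hvRT]
      · have := hapS hz
        simp only [hc.adj_apex, hvRS, hvRT, hvt₀, hvs₀, hSRT hz, if_true, if_false, or_false]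
        linarith
      · have := hapT hz
        simp only [hc.adj_apex, hvRS, hvRT, hvt₀, hvs₀, hTRS hz, if_true, if_false, false_or]
        linarith
      · have := hapS hw
        simp only [hc.adj_left hw, G.adj_comm w, hvRS, hvRT, hvt₀, hvs₀, hSRT hw, hvT, if_true,
          if_false, false_or, true_and]
        linarith
      · simp [hSS w hw z hz, hSRT hw, hSRT hz, hnS hw, hnS hz, hc.adj_left hw, hST hz]
      · have := hleft hw hz
        simp only [hc.adj_left hw, hSRT hw, hTRS hz, hnS hw, hnT hz, hz, if_true, if_false, true_or]
        linarith
      · have := hapT hw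
        simp only [hc.adj_right hw, G.adj_comm w, hvRS, hvRT, hvt₀, hvs₀, hTRS hw, hvS, if_true,
          if_false, false_or, true_and]
        linarith
      · have := hleft hz hw
        simp only [hc.adj_right hw, G.adj_comm w, hSRT hz, hTRS hw, hnS hz, hnT hw, hz, if_true,
          if_false, true_or]
        linarith
      · simp [hTT w hw z hz, hTRS hw, hTRS hz, hnT hw, hnT hz, hc.adj_right hw, hTS hz]
    have h1 : 0 ≤ 2 * (x t₀ - x v) * ∑ z ∈ RS, x z := by
      rcases RS.eq_empty_or_nonempty with h | ⟨s, hs⟩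
      · simp [h]
      · simp only [hRS, Finset.mem_filter] at hs
        have := (hS₀P ⟨s, hs⟩).2
        exact mul_nonneg (by linarith) (Finset.sum_nonneg fun w _ => hx0 w)
    have h2 : 0 ≤ 2 * (x s₀ - x v) * ∑ z ∈ RT, x z :=
      mul_nonneg (by linarith [hxS s₀ hs₀ hvs]) (Finset.sum_nonneg fun w _ => hx0 w)
    rw [← sum_switch] at h1 h2
    rw [sum_mul_sum_adj_eq, sum_mul_sum_adj_eq]
    refine (le_add_of_nonneg_right (add_nonneg h1 h2)).trans ?_
    rw [← Finset.sum_add_distrib, ← Finset.sum_add_distrib]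
    refine Finset.sum_le_sum fun w _ => ?_
    rw [← Finset.sum_add_distrib, ← Finset.sum_add_distrib]
    refine Finset.sum_le_sum fun z _ => ?_
    rw [← add_mul, ← add_mul, ← add_assoc]
    exact mul_le_mul_of_nonneg_right (key w z) (mul_nonneg (hx0 w) (hx0 z))
  -- A recipient of moved edges loses none and gains some, so its row grows strictly. If nothing is
  -- moved, `G` is a subgraph of the cone graph.
  · by_cases h1 : ∃ s ∈ S, G.Adj v s ∧ s ∉ P
    · obtain ⟨s, hs, hvs, hsP⟩ := h1
      refine ⟨t₀, fun z hz => ?_, s, (hc.adj_right ht₀ s).2 (Or.inl hs), hnadjS s hs hvs hsP⟩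
      rw [hc.adj_right ht₀]
      rcases hcover z with rfl | h | h
      · exact Or.inr ⟨rfl, ht₀Q⟩
      · exact Or.inl h
      · exact absurd hz (hTT _ ht₀ _ h)
    by_cases h2 : ∃ t ∈ T, G.Adj v t ∧ t ∉ Q
    · obtain ⟨t, ht, hvt, htQ⟩ := h2
      refine ⟨s₀, fun z hz => ?_, t, (hc.adj_left hs₀ t).2 (Or.inl ht), hnadjT t ht hvt htQ⟩
      rw [hc.adj_left hs₀]
      rcases hcover z with rfl | h | h
      · exact Or.inr ⟨rfl, hs₀P⟩
      · exact absurd hz (hSS _ hs₀ _ h)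
      · exact Or.inl h
    push Not at h1 h2
    have hle : G ≤ coneGraph v S T P Q := by
      intro w z hwz
      rcases hcover w with rfl | hw | hw
      · rw [hc.adj_apex]
        rcases hcover z with rfl | hz | hz
        · exact absurd hwz (G.loopless.irrefl _)
        · exact Or.inl (h1 z hz hwz)
        · exact Or.inr (h2 z hz hwz)
      · rw [hc.adj_left hw]
        rcases hcover z with rfl | hz | hz
        · exact Or.inr ⟨rfl, h1 w hw hwz.symm⟩
        · exact absurd hwz (hSS _ hw _ hz)
        · exact Or.inl hz
      · rw [hc.adj_right hw]
        rcases hcover z with rfl | hz | hz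
        · exact Or.inr ⟨rfl, h2 w hw hwz.symm⟩
        · exact Or.inl hz
        · exact absurd hwz (hTT _ hw _ hz)
    by_contra! h
    refine hne (le_antisymm hle fun w z hwz => ?_)
    exact h w (fun z hz => hle hz) z hwz

end Switching

/-! ### Nonadjacent pairs across a partition, and edges inside its parts. -/

section Partition

variable {V : Type*}

/-- The number of neighbours of `w` in `P`. -/
noncomputable def degIn (G : SimpleGraph V) (P : Finset V) (w : V) : ℝ :=
  (P.filter (G.Adj w)).card

variable (G : SimpleGraph V) {P Q : Finset V} {r : ℕ}

lemma degIn_le_card (P : Finset V) (w : V) : G.degIn P w ≤ P.card := by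
  rw [degIn]
  exact_mod_cast Finset.card_filter_le _ _

lemma degIn_eq_sum (P : Finset V) (w : V) :
    G.degIn P w = ∑ z ∈ P, if G.Adj w z then (1 : ℝ) else 0 := by
  rw [degIn, Finset.sum_boole]

lemma card_sub_degIn_eq_sum (P : Finset V) (w : V) :
    P.card - G.degIn P w = ∑ z ∈ P, if G.Adj w z then (0 : ℝ) else 1 := by
  rw [degIn_eq_sum, Finset.cast_card, ← Finset.sum_sub_distrib]
  exact Finset.sum_congr rfl fun z _ => by split_ifs <;> simp

/-- Both sides count the nonadjacent pairs between `P` and `Q`. -/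
lemma sum_card_sub_degIn_comm (P Q : Finset V) :
    ∑ w ∈ P, (Q.card - G.degIn Q w) = ∑ z ∈ Q, (P.card - G.degIn P z) := by
  simp only [card_sub_degIn_eq_sum]
  rw [Finset.sum_comm]
  simp only [G.adj_comm]

variable {G}

lemma degIn_add_degIn_le [Fintype V]
    (hcod : ∀ w z, G.Adj w z → (Finset.univ.filter fun y => G.Adj w y ∧ G.Adj z y).card ≤ r)
    (Q : Finset V) {w z : V} (h : G.Adj w z) : G.degIn Q w + G.degIn Q z ≤ Q.card + r := by
  have h1 := Finset.card_union_add_card_inter (Q.filter (G.Adj w)) (Q.filter (G.Adj z))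
  have h2 : (Q.filter (G.Adj w) ∪ Q.filter (G.Adj z)).card ≤ Q.card :=
    Finset.card_le_card (Finset.union_subset (Finset.filter_subset _ _) (Finset.filter_subset _ _))
  have h3 : (Q.filter (G.Adj w) ∩ Q.filter (G.Adj z)).card ≤ r := by
    refine (Finset.card_le_card fun y hy => ?_).trans (hcod w z h)
    simp only [Finset.mem_inter, Finset.mem_filter] at hy
    simp [hy.1.2, hy.2.2]
  rw [degIn, degIn]
  norm_cast
  omega

/-- The ends of an edge share at most `r` neighbours, so together they miss at least `|Q| - r`
vertices of `Q`; disjoint edges contribute independently. -/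
lemma card_sub_le_of_disjoint_edges [Fintype V]
    (hcod : ∀ w z, G.Adj w z → (Finset.univ.filter fun y => G.Adj w y ∧ G.Adj z y).card ≤ r)
    {w z w' z' : V} (hw : w ∈ P) (hz : z ∈ P) (hw' : w' ∈ P) (hz' : z' ∈ P)
    (h : G.Adj w z) (h' : G.Adj w' z') (h1 : w ≠ w') (h2 : w ≠ z') (h3 : z ≠ w') (h4 : z ≠ z') :
    2 * ((Q.card : ℝ) - r) ≤ ∑ w ∈ P, (Q.card - G.degIn Q w) := by
  have hsub : ({w, z, w', z'} : Finset V) ⊆ P := by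
    intro y hy
    simp only [Finset.mem_insert, Finset.mem_singleton] at hy
    rcases hy with rfl | rfl | rfl | rfl <;> assumption
  have := Finset.sum_le_sum_of_subset_of_nonneg (f := fun w => (Q.card : ℝ) - G.degIn Q w) hsub
    fun y _ _ => sub_nonneg.2 (G.degIn_le_card Q y)
  rw [Finset.sum_insert (by simp [h.ne, h1, h2]), Finset.sum_insert (by simp [h3, h4]),
    Finset.sum_insert (by simp [h'.ne]), Finset.sum_singleton] at this
  linarith [degIn_add_degIn_le hcod Q h, degIn_add_degIn_le hcod Q h']

/-- Sum the bound over the three edges: each vertex is counted twice. -/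
lemma card_sub_le_of_triangle [Fintype V]
    (hcod : ∀ w z, G.Adj w z → (Finset.univ.filter fun y => G.Adj w y ∧ G.Adj z y).card ≤ r)
    {w z y : V} (hw : w ∈ P) (hz : z ∈ P) (hy : y ∈ P)
    (h1 : G.Adj w z) (h2 : G.Adj z y) (h3 : G.Adj w y) :
    3 * ((Q.card : ℝ) - r) ≤ 2 * ∑ w ∈ P, (Q.card - G.degIn Q w) := by
  have hsub : ({w, z, y} : Finset V) ⊆ P := by
    intro y hy
    simp only [Finset.mem_insert, Finset.mem_singleton] at hy
    rcases hy with rfl | rfl | rfl <;> assumption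
  have := Finset.sum_le_sum_of_subset_of_nonneg (f := fun w => (Q.card : ℝ) - G.degIn Q w) hsub
    fun y _ _ => sub_nonneg.2 (G.degIn_le_card Q y)
  rw [Finset.sum_insert (by simp [h1.ne, h3.ne]), Finset.sum_insert (by simp [h2.ne]),
    Finset.sum_singleton] at this
  linarith [degIn_add_degIn_le hcod Q h1, degIn_add_degIn_le hcod Q h2,
    degIn_add_degIn_le hcod Q h3]

/-- The two edges force missing pairs from either side; at most the four pairs between their ends
are counted twice. -/
lemma card_add_card_sub_le_of_edges [Fintype V]
    (hcod : ∀ w z, G.Adj w z → (Finset.univ.filter fun y => G.Adj w y ∧ G.Adj z y).card ≤ r)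
    {w w' z z' : V} (hw : w ∈ P) (hw' : w' ∈ P) (hz : z ∈ Q) (hz' : z' ∈ Q)
    (h : G.Adj w w') (h' : G.Adj z z') :
    ((Q.card : ℝ) - r) + (P.card - r) - 4 ≤ ∑ w ∈ P, (Q.card - G.degIn Q w) := by
  set g : V → ℝ := fun y => (if G.Adj z y then 0 else 1) + if G.Adj z' y then 0 else 1 with hg
  have hg2 : ∀ y, g y ≤ 2 := fun y => by simp only [hg]; split_ifs <;> norm_num
  have hgf : ∀ y, g y ≤ Q.card - G.degIn Q y := by
    intro y
    have hsub : ({z, z'} : Finset V) ⊆ Q := by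
      intro y hy
      simp only [Finset.mem_insert, Finset.mem_singleton] at hy
      rcases hy with rfl | rfl <;> assumption
    have := Finset.sum_le_sum_of_subset_of_nonneg
      (f := fun x => if G.Adj y x then (0 : ℝ) else 1) hsub fun y _ _ => by split_ifs <;> norm_num
    rw [card_sub_degIn_eq_sum]
    refine le_trans (le_of_eq ?_) this
    rw [Finset.sum_pair h'.ne]
    simp only [hg, G.adj_comm y]
  have hsum : ∑ y ∈ P, g y = (P.card - G.degIn P z) + (P.card - G.degIn P z') := by
    rw [card_sub_degIn_eq_sum, card_sub_degIn_eq_sum, ← Finset.sum_add_distrib]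
  have hsub : ({w, w'} : Finset V) ⊆ P := by
    intro y hy
    simp only [Finset.mem_insert, Finset.mem_singleton] at hy
    rcases hy with rfl | rfl <;> assumption
  have := Finset.sum_le_sum_of_subset_of_nonneg
    (f := fun y => (Q.card : ℝ) - G.degIn Q y - g y) hsub fun y _ _ => sub_nonneg.2 (hgf y)
  rw [Finset.sum_pair h.ne, Finset.sum_sub_distrib, hsum] at this
  linarith [hg2 w, hg2 w', degIn_add_degIn_le hcod Q h, degIn_add_degIn_le hcod P h']

/-- A graph with no two disjoint edges and no triangle is a star. -/
lemma exists_star_center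
    (hdisj : ∀ w ∈ P, ∀ z ∈ P, ∀ w' ∈ P, ∀ z' ∈ P, G.Adj w z → G.Adj w' z' →
      w ≠ w' → w ≠ z' → z ≠ w' → z ≠ z' → False)
    (htri : ∀ w ∈ P, ∀ z ∈ P, ∀ y ∈ P, G.Adj w z → G.Adj z y → G.Adj w y → False)
    {w₀ z₀ : V} (hw₀ : w₀ ∈ P) (hz₀ : z₀ ∈ P) (h₀ : G.Adj w₀ z₀) :
    ∃ v ∈ P, (∃ w ∈ P, G.Adj v w) ∧ ∀ w ∈ P, ∀ z ∈ P, G.Adj w z → w = v ∨ z = v := by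
  by_cases h1 : ∀ w ∈ P, ∀ z ∈ P, G.Adj w z → w = w₀ ∨ z = w₀
  · exact ⟨w₀, hw₀, ⟨z₀, hz₀, h₀⟩, h1⟩
  refine ⟨z₀, hz₀, ⟨w₀, hw₀, h₀.symm⟩, ?_⟩
  push Not at h1
  have h2 : ∃ y ∈ P, G.Adj z₀ y ∧ y ≠ w₀ := by
    obtain ⟨w, hw, z, hz, hwz, h3, h4⟩ := h1
    by_cases h5 : w = z₀
    · exact ⟨z, hz, h5 ▸ hwz, h4⟩
    by_cases h6 : z = z₀
    · exact ⟨w, hw, h6 ▸ hwz.symm, h3⟩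
    exact (hdisj w₀ hw₀ z₀ hz₀ w hw z hz h₀ hwz (Ne.symm h3) (Ne.symm h4) (Ne.symm h5)
      (Ne.symm h6)).elim
  obtain ⟨y, hy, hzy, hyw⟩ := h2
  intro w hw z hz hwz
  by_contra! hne
  -- An edge avoiding `z₀` must meet both `z₀w₀` and `z₀y`, hence is `w₀y` and closes a triangle.
  have e1 : w = w₀ ∨ z = w₀ := by
    by_contra! h
    exact hdisj w₀ hw₀ z₀ hz₀ w hw z hz h₀ hwz h.1.symm h.2.symm hne.1.symm hne.2.symm
  have e2 : w = y ∨ z = y := by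
    by_contra! h
    exact hdisj z₀ hz₀ y hy w hw z hz hzy hwz hne.1.symm hne.2.symm h.1.symm h.2.symm
  have hwy : G.Adj w₀ y := by
    rcases e1 with rfl | rfl <;> rcases e2 with rfl | rfl
    · exact absurd rfl hyw
    · exact hwz
    · exact hwz.symm
    · exact absurd rfl hyw
  exact htri w₀ hw₀ z₀ hz₀ y hy h₀ hzy hwy

/-- The centre of a star can be chosen such that, if the star has a single edge, the centre has
the smaller weight. -/
lemma exists_star_center_of_weight (x : V → ℝ) {v : V} (hv : v ∈ P) (hvw : ∃ w ∈ P, G.Adj v w)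
    (hstar : ∀ w ∈ P, ∀ z ∈ P, G.Adj w z → w = v ∨ z = v) :
    ∃ v ∈ P, (∃ w ∈ P, G.Adj v w) ∧ (∀ w ∈ P, ∀ z ∈ P, G.Adj w z → w = v ∨ z = v) ∧
      (2 ≤ G.degIn P v ∨ G.degIn P v = 1 ∧ ∀ w ∈ P, G.Adj v w → x v ≤ x w) := by
  obtain ⟨w, hw, hadj⟩ := hvw
  have hmem : w ∈ P.filter (G.Adj v) := by simp [hw, hadj]
  by_cases h2 : 2 ≤ (P.filter (G.Adj v)).card
  · exact ⟨v, hv, ⟨w, hw, hadj⟩, hstar, Or.inl (by rw [degIn]; exact_mod_cast h2)⟩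
  have h1 : (P.filter (G.Adj v)).card = 1 := by
    have := Finset.card_pos.2 ⟨w, hmem⟩
    omega
  have huniq : ∀ z ∈ P, G.Adj v z → z = w := fun z hz hvz =>
    Finset.card_le_one.1 h1.le z (by simp [hz, hvz]) w hmem
  rcases le_total (x v) (x w) with hle | hle
  · exact ⟨v, hv, ⟨w, hw, hadj⟩, hstar, Or.inr ⟨by rw [degIn, h1, Nat.cast_one],
      fun z hz hvz => by rw [huniq z hz hvz]; exact hle⟩⟩
  · have hw1 : ∀ z ∈ P, G.Adj w z → z = v := fun z hz hwz =>
      (hstar w hw z hz hwz).resolve_left hadj.ne'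
    have h1' : P.filter (G.Adj w) = {v} := by
      ext z
      simp only [Finset.mem_filter, Finset.mem_singleton]
      exact ⟨fun h => hw1 z h.1 h.2, by rintro rfl; exact ⟨hv, hadj.symm⟩⟩
    refine ⟨w, hw, ⟨v, hv, hadj.symm⟩, fun y hy z hz hyz => ?_, Or.inr ⟨by simp [degIn, h1'],
      fun z hz hwz => by rw [hw1 z hz hwz]; exact hle⟩⟩
    rcases hstar y hy z hz hyz with rfl | rfl
    · exact Or.inr (huniq z hz hyz)
    · exact Or.inl (huniq y hy hyz.symm)

lemma isBipartite_of_partition (hcover : ∀ w, w ∈ P ∨ w ∈ Q)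
    (hP : ∀ w ∈ P, ∀ z ∈ P, ¬ G.Adj w z) (hQ : ∀ w ∈ Q, ∀ z ∈ Q, ¬ G.Adj w z) :
    G.IsBipartite := by
  refine ⟨Coloring.mk (fun w => if w ∈ P then 0 else 1) fun {w z} h heq => ?_⟩
  by_cases hw : w ∈ P <;> by_cases hz : z ∈ P
  · exact hP w hw z hz h
  · simp [hw, hz] at heq
  · simp [hw, hz] at heq
  · exact hQ w ((hcover w).resolve_left hw) z ((hcover z).resolve_left hz) h

lemma card_common_nbrs_le_of_book_free [Fintype V] (h : (book (r + 1)).Free G) (w z : V)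
    (hwz : G.Adj w z) : (Finset.univ.filter fun y => G.Adj w y ∧ G.Adj z y).card ≤ r := by
  by_contra! hlt
  obtain ⟨f⟩ : Nonempty (Fin (r + 1) ↪ (Finset.univ.filter fun y => G.Adj w y ∧ G.Adj z y)) :=
    Function.Embedding.nonempty_of_card_le (by rw [Fintype.card_fin, Fintype.card_coe]; omega)
  have hf : ∀ i, G.Adj w (f i) ∧ G.Adj z (f i) := fun i =>
    (Finset.mem_filter.1 (f i).2).2
  have h01 : ∀ a : Fin 2, G.Adj (![w, z] a) (![w, z] (1 - a)) := by
    intro a; fin_cases a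
    · simpa using hwz
    · simpa using hwz.symm
  have h2 : ∀ (a : Fin 2) i, G.Adj (![w, z] a) (f i) := by
    intro a i; fin_cases a
    · exact (hf i).1
    · exact (hf i).2
  let g : Fin 2 ⊕ Fin (r + 1) → V := Sum.elim ![w, z] fun i => f i
  have hab : ∀ a b : Fin 2, a ≠ b → b = 1 - a := by decide
  refine h ⟨⟨⟨g, ?_⟩, ?_⟩⟩
  · rintro (a | i) (b | j) hadj
    · rw [hab a b hadj]; exact h01 a
    · exact h2 a j
    · exact (h2 b i).symm
    · exact hadj.elim
  · rintro (a | i) (b | j) hij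
    · by_contra hne
      have hne' : a ≠ b := fun h => hne (by rw [h])
      have := h01 a
      rw [← hab a b hne'] at this
      exact this.ne hij
    · exact absurd hij (h2 a j).ne
    · exact absurd hij (h2 b i).ne'
    · have : f i = f j := Subtype.ext hij
      rw [f.injective this]

end Partition

/-! ### Weights around the centre of a star. -/

section Structure

variable {V : Type*} {G : SimpleGraph V} {r : ℕ} {P Q : Finset V} {x : V → ℝ} {μ : ℝ}

lemma sum_sub_le_sum_adj [Fintype V] (hx0 : ∀ w, 0 ≤ x w) (hx1 : ∀ w, x w ≤ 1) (Q : Finset V) (w : V) :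
    ∑ z ∈ Q, x z - (Q.card - G.degIn Q w) ≤ ∑ z with G.Adj w z, x z := by
  have h1 : ∑ z ∈ Q with G.Adj w z, x z ≤ ∑ z with G.Adj w z, x z :=
    Finset.sum_le_sum_of_subset_of_nonneg
      (Finset.filter_subset_filter _ (Finset.subset_univ _)) fun z _ _ => hx0 z
  refine le_trans ?_ h1
  rw [card_sub_degIn_eq_sum, ← Finset.sum_sub_distrib, Finset.sum_filter]
  refine Finset.sum_le_sum fun z _ => ?_
  split_ifs
  · simp
  · linarith [hx1 z]

lemma sum_adj_eq_add [Fintype V] (hdisj : Disjoint P Q) (hcover : ∀ w, w ∈ P ∨ w ∈ Q) (x : V → ℝ) (w : V) :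
    ∑ z with G.Adj w z, x z = ∑ z ∈ P with G.Adj w z, x z + ∑ z ∈ Q with G.Adj w z, x z := by
  rw [← Finset.sum_union (Finset.disjoint_filter_filter hdisj)]
  congr 1
  ext z
  have := hcover z
  simp only [Finset.mem_filter, Finset.mem_union, Finset.mem_univ, true_and]
  tauto

lemma sum_filter_adj_le_degIn (hx1 : ∀ w, x w ≤ 1) (P : Finset V) (w : V) :
    ∑ z ∈ P with G.Adj w z, x z ≤ G.degIn P w := by
  rw [degIn, Finset.cast_card]
  exact Finset.sum_le_sum fun z _ => hx1 z

/-- The edges inside `P` are covered by the vertices having many non-neighbours in `Q`. -/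
lemma sum_degIn_le_mul_card [Fintype V]
    (hcod : ∀ w z, G.Adj w z → (Finset.univ.filter fun y => G.Adj w y ∧ G.Adj z y).card ≤ r)
    (hdeg : ∀ w ∈ P, G.degIn P w ≤ r) :
    ∑ w ∈ P, G.degIn P w ≤
      2 * r * (P.filter fun w => (Q.card : ℝ) - r ≤ 2 * (Q.card - G.degIn Q w)).card := by
  set L := P.filter fun w => (Q.card : ℝ) - r ≤ 2 * (Q.card - G.degIn Q w) with hL
  have hcov : ∀ w ∈ P, ∀ z ∈ P, G.Adj w z → w ∈ L ∨ z ∈ L := by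
    intro w hw z hz hwz
    by_contra! h
    simp only [hL, Finset.mem_filter, hw, hz, true_and, not_le] at h
    linarith [degIn_add_degIn_le hcod Q hwz, h.1, h.2]
  have hsumL : ∑ w ∈ P, (if w ∈ L then G.degIn P w else 0) ≤ r * L.card := by
    rw [← Finset.sum_filter, Finset.filter_mem_eq_inter,
      Finset.inter_eq_right.2 (Finset.filter_subset _ _), mul_comm, ← nsmul_eq_mul]
    exact Finset.sum_le_card_nsmul _ _ _ fun w hw => hdeg w (Finset.mem_filter.1 hw).1
  have h1 : ∑ w ∈ P, G.degIn P w ≤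
      ∑ w ∈ P, ∑ z ∈ P, ((if w ∈ L then if G.Adj w z then (1 : ℝ) else 0 else 0) +
        if z ∈ L then if G.Adj z w then (1 : ℝ) else 0 else 0) := by
    refine Finset.sum_le_sum fun w hw => ?_
    rw [degIn_eq_sum]
    refine Finset.sum_le_sum fun z hz => ?_
    rw [G.adj_comm z w]
    by_cases h : G.Adj w z
    · rcases hcov w hw z hz h with h' | h'
      · simp only [h, h', if_true]
        split_ifs <;> norm_num
      · simp only [h, h', if_true]
        split_ifs <;> norm_num
    · simp [h]
  have h2 : ∑ w ∈ P, ∑ z ∈ P, (if w ∈ L then if G.Adj w z then (1 : ℝ) else 0 else 0) =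
      ∑ w ∈ P, (if w ∈ L then G.degIn P w else 0) := by
    refine Finset.sum_congr rfl fun w _ => ?_
    split_ifs
    · rw [degIn_eq_sum]
    · simp
  have h3 : ∑ w ∈ P, ∑ z ∈ P, (if z ∈ L then if G.Adj z w then (1 : ℝ) else 0 else 0) =
      ∑ w ∈ P, (if w ∈ L then G.degIn P w else 0) := by
    rw [Finset.sum_comm, h2]
  simp only [Finset.sum_add_distrib] at h1
  rw [h2, h3] at h1
  linarith

/-- Markov's inequality for the number of missing neighbours. -/
lemma mul_card_le_sum_card_sub_degIn (c : ℝ) :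
    c * (P.filter fun w => c ≤ 2 * (Q.card - G.degIn Q w)).card ≤
      2 * ∑ w ∈ P, ((Q.card : ℝ) - G.degIn Q w) := by
  rw [Finset.mul_sum, mul_comm, ← nsmul_eq_mul]
  refine (Finset.card_nsmul_le_sum _ (fun w => 2 * ((Q.card : ℝ) - G.degIn Q w)) c
    fun w hw => (Finset.mem_filter.1 hw).2).trans ?_
  exact Finset.sum_le_sum_of_subset_of_nonneg (Finset.filter_subset _ _)
    fun w _ _ => mul_nonneg zero_le_two (sub_nonneg.2 (G.degIn_le_card Q w))

/-- If all edges inside the parts of a nearly complete bipartite partition form a star in one part,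
the hypotheses of `exists_coneGraph_quadratic_le` hold. -/
lemma exists_star_data [Fintype V] (hr : 1 ≤ r) {n : ℝ}
    (hbip : ¬ G.IsBipartite)
    (hcod : ∀ w z, G.Adj w z → (Finset.univ.filter fun y => G.Adj w y ∧ G.Adj z y).card ≤ r)
    (hx0 : ∀ w, 0 ≤ x w) (hx1 : ∀ w, x w ≤ 1) (hμ : 0 < μ)
    (hx : ∀ w, ∑ z with G.Adj w z, x z = μ * x w)
    (hdisj : Disjoint P Q) (hcover : ∀ w, w ∈ P ∨ w ∈ Q) (hcard : (P.card + Q.card : ℝ) = n)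
    (hQQ : ∀ w ∈ Q, ∀ z ∈ Q, ¬ G.Adj w z)
    {v : V} (hv : v ∈ P) (hvw : ∃ w ∈ P, G.Adj v w)
    (hstar : ∀ w ∈ P, ∀ z ∈ P, G.Adj w z → w = v ∨ z = v)
    (hweight : 2 ≤ G.degIn P v ∨ G.degIn P v = 1 ∧ ∀ w ∈ P, G.Adj v w → x v ≤ x w)
    {e : ℝ} (he : e = 0 ∨ e = 2 * G.degIn P v ∧ G.degIn P v ≤ r)
    (hM : ∑ w ∈ P, (Q.card - G.degIn Q w) < n / 2 + e - (P.card - Q.card : ℝ) ^ 2 / 4)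
    (hP : 3 * (r : ℝ) ^ 2 + 3 * r + 11 ≤ ∑ w ∈ P, x w)
    (hQ : 3 * (r : ℝ) ^ 2 + 3 * r + 11 ≤ ∑ w ∈ Q, x w) :
    ∃ (v : V) (S T : Finset V), Disjoint S T ∧ v ∉ S ∧ v ∉ T ∧ (∀ w, w = v ∨ w ∈ S ∨ w ∈ T) ∧
      r ≤ S.card ∧ r ≤ T.card ∧
      (∀ w ∈ S, ∀ z ∈ S, ¬ G.Adj w z) ∧ (∀ w ∈ T, ∀ z ∈ T, ¬ G.Adj w z) ∧
      (∃ s ∈ S, G.Adj v s) ∧ (∃ t ∈ T, G.Adj v t) ∧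
      (∀ s ∈ S, G.Adj v s → x v ≤ x s) ∧
      (r < (S.filter (G.Adj v)).card → ∀ t ∈ T, G.Adj v t → x v ≤ x t) := by
  set S := P.erase v with hS
  have hr' : (1 : ℝ) ≤ r := by exact_mod_cast hr
  have hvS : v ∉ S := by simp [hS]
  have hPQ : ∀ {w}, w ∈ P → w ∉ Q := fun h => Finset.disjoint_left.1 hdisj h
  have hvQ : v ∉ Q := hPQ hv
  have hSP : S ⊆ P := Finset.erase_subset _ _
  have hmemS : ∀ {w}, w ∈ S ↔ w ≠ v ∧ w ∈ P := Finset.mem_erase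
  have hSS : ∀ w ∈ S, ∀ z ∈ S, ¬ G.Adj w z := fun w hw z hz hwz =>
    (hstar w (hSP hw) z (hSP hz) hwz).elim (hmemS.1 hw).1 (hmemS.1 hz).1
  have hSQ : Disjoint S Q := hdisj.mono_left hSP
  have hcover' : ∀ w, w = v ∨ w ∈ S ∨ w ∈ Q := fun w => by
    rw [hmemS]
    have := hcover w
    tauto
  have hnQ : ∃ t ∈ Q, G.Adj v t := by
    by_contra! h
    refine hbip (isBipartite_of_partition (P := S) (Q := insert v Q) (fun w => ?_) hSS ?_)
    · rw [Finset.mem_insert]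
      have := hcover' w
      tauto
    · intro w hw z hz hwz
      rcases Finset.mem_insert.1 hw with hw | hw <;>
        rcases Finset.mem_insert.1 hz with hz | hz
      · exact hwz.ne (hw.trans hz.symm)
      · exact h z hz (hw ▸ hwz)
      · exact h w hw (hz ▸ hwz.symm)
      · exact hQQ w hw z hz hwz
  have hnS : ∃ s ∈ S, G.Adj v s := by
    obtain ⟨w, hw, hvw⟩ := hvw
    exact ⟨w, hmemS.2 ⟨hvw.ne', hw⟩, hvw⟩
  have hdegS : S.filter (G.Adj v) = P.filter (G.Adj v) := by
    ext w
    simp only [Finset.mem_filter, hmemS]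
    exact ⟨fun h => ⟨h.1.2, h.2⟩, fun h => ⟨⟨h.2.ne', h.1⟩, h.2⟩⟩
  have hdegS' : G.degIn S v = G.degIn P v := by rw [degIn, degIn, hdegS]
  have hsumS : ∑ w ∈ S, x w = ∑ w ∈ P, x w - x v := by
    rw [← Finset.sum_erase_add P _ hv]; ring
  have hcardle : ∀ A : Finset V, ∑ w ∈ A, x w ≤ A.card := fun A => by
    rw [Finset.cast_card]; exact Finset.sum_le_sum fun w _ => hx1 w
  have hSr : r ≤ S.card := by
    have h1 := hcardle S
    have h2 := hx1 v
    have : (r : ℝ) ≤ S.card := by nlinarith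
    exact_mod_cast this
  have hQr : r ≤ Q.card := by
    have h1 := hcardle Q
    have : (r : ℝ) ≤ Q.card := by nlinarith
    exact_mod_cast this
  set i := G.degIn P v with hi
  set o := G.degIn Q v with ho
  have hi1 : 1 ≤ i := by rcases hweight with h | h <;> linarith
  have ho1 : 1 ≤ o := by
    obtain ⟨t, ht, hvt⟩ := hnQ
    have : 0 < (Q.filter (G.Adj v)).card := Finset.card_pos.2 ⟨t, by simp [ht, hvt]⟩
    rw [ho, degIn]
    exact_mod_cast this
  set M' := ∑ w ∈ S, ((Q.card : ℝ) - G.degIn Q w) with hM'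
  -- Removing `v` drops `|Q| - o` missing pairs. With `d = |P| - |Q|`, what remains is at most `o +
  -- e + d/2 - d²/4`, and the last two terms are at most `1/4`.
  have hM'1 : M' < o + e + 1 / 4 := by
    rw [← Finset.sum_erase_add P _ hv] at hM
    nlinarith [sq_nonneg ((P.card - Q.card : ℝ) - 1)]
  have hM'2 : M' = ∑ z ∈ Q, ((S.card : ℝ) - G.degIn S z) := G.sum_card_sub_degIn_comm S Q
  have hM'3 : i * (o - r) ≤ M' := by
    have h1 := Finset.card_nsmul_le_sum (S.filter (G.Adj v))
      (fun w => (Q.card : ℝ) - G.degIn Q w) (o - r) fun w hw => by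
        have := degIn_add_degIn_le hcod Q (Finset.mem_filter.1 hw).2
        linarith
    rw [nsmul_eq_mul] at h1
    rw [← hdegS', degIn]
    exact h1.trans (Finset.sum_le_sum_of_subset_of_nonneg (Finset.filter_subset _ _)
      fun w _ _ => sub_nonneg.2 (G.degIn_le_card Q w))
  have hM'4 : o * (i - r) ≤ M' := by
    have h1 := Finset.card_nsmul_le_sum (Q.filter (G.Adj v))
      (fun w => (S.card : ℝ) - G.degIn S w) (i - r) fun w hw => by
        have := degIn_add_degIn_le hcod S (Finset.mem_filter.1 hw).2
        rw [hdegS'] at this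
        linarith
    rw [nsmul_eq_mul] at h1
    rw [hM'2, ho, degIn]
    exact h1.trans (Finset.sum_le_sum_of_subset_of_nonneg (Finset.filter_subset _ _)
      fun w _ _ => sub_nonneg.2 (G.degIn_le_card S w))
  have hxv : μ * x v ≤ o + i := by
    rw [← hx, sum_adj_eq_add hdisj hcover]
    linarith [sum_filter_adj_le_degIn (G := G) hx1 P v, sum_filter_adj_le_degIn (G := G) hx1 Q v]
  have hxS : ∀ w ∈ S, ∑ z ∈ Q, x z - M' ≤ μ * x w := by
    intro w hw
    have h1 := sum_sub_le_sum_adj (G := G) hx0 hx1 Q w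
    have h2 := Finset.single_le_sum (f := fun w => (Q.card : ℝ) - G.degIn Q w)
      (fun w _ => sub_nonneg.2 (G.degIn_le_card Q w)) hw
    rw [hx] at h1
    linarith
  have hxQ : ∀ w ∈ Q, ∑ z ∈ S, x z - M' ≤ μ * x w := by
    intro w hw
    have h1 := sum_sub_le_sum_adj (G := G) hx0 hx1 S w
    have h2 := Finset.single_le_sum (f := fun w => (S.card : ℝ) - G.degIn S w)
      (fun w _ => sub_nonneg.2 (G.degIn_le_card S w)) hw
    rw [hx] at h1
    linarith
  -- The centre has only `o + i` neighbours, while any other vertex misses at most `M'` of the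
  -- opposite part. The extra `1` pays for removing `x v` from the sum over `P`. The tight case is
  -- `r = 1` with `e = 2i`, where the left side is at most `16.75` against `17`.
  have hall : 2 ≤ i → (∀ w ∈ S, x v ≤ x w) ∧ ∀ w ∈ Q, x v ≤ x w := by
    intro hi2
    have hbound : M' + 1 + (o + i) ≤ 3 * (r : ℝ) ^ 2 + 3 * r + 11 := by
      rcases he with he | ⟨he, hir⟩
      · have h1 : i - r ≤ 5 / 4 := by nlinarith
        have h2 : o ≤ 2 * r + 1 / 4 := by
          by_contra! h
          nlinarith
        nlinarith
      · have h2 : o ≤ 2 * r + 17 / 4 := by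
          by_contra! h
          nlinarith
        nlinarith
    have hv1 := hx1 v
    constructor
    · intro w hw
      refine le_of_mul_le_mul_left ?_ hμ
      linarith [hxS w hw]
    · intro w hw
      refine le_of_mul_le_mul_left ?_ hμ
      linarith [hxQ w hw]
  refine ⟨v, S, Q, hSQ, hvS, hvQ, hcover', hSr, hQr, hSS, hQQ, hnS, hnQ, ?_, ?_⟩
  · rcases hweight with h | h
    · exact fun s hs _ => (hall h).1 s hs
    · exact fun s hs hvs => h.2 s (hSP hs) hvs
  · intro hlt t ht _
    refine (hall ?_).2 t ht
    rcases hweight with h | h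
    · exact h
    -- A star with a single edge has no surplus, as `r ≥ 1`.
    · have : (r : ℝ) < G.degIn P v := by rw [degIn, ← hdegS]; exact_mod_cast hlt
      linarith [h.1]

end Structure

/-! ### Inequalities that use the size of `n`. -/

section Numerics

variable {r n a b l M E : ℝ}

/-- A part below `n/3` would bound `l` by about `2n²/9`, less than `n²/4`. -/
lemma third_le_card_of_walks (hr : 1 ≤ r) (hn : 8 * (r ^ 2 + r + 4) ≤ n) (hab : a + b = n)
    (hl : n ^ 2 - 2 * n < 4 * l) (h : l ≤ b * (a + r)) : n / 3 ≤ a ∧ n / 3 ≤ b := by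
  obtain rfl : b = n - a := by linarith
  have hn1 : 24 * r + 18 ≤ n := by nlinarith [sq_nonneg (r - 1)]
  constructor
  · by_contra! hlt
    have h1 : 0 ≤ (n / 3 - a) * (n - n / 3 - a - r) := mul_nonneg (by linarith) (by linarith)
    nlinarith
  · by_contra! hlt
    have h1 : 0 ≤ (n / 3 - (n - a)) * (n + r - n / 3 - (n - a)) :=
      mul_nonneg (by linarith) (by linarith)
    nlinarith

lemma inner_degree_sum_le (hr : 1 ≤ r) (hn : 8 * (r ^ 2 + r + 4) ≤ n) (hab : a + b = n)
    (hl : n ^ 2 - 2 * n < 4 * l) (h : l ≤ a * b - M + E) (ha : n / 3 ≤ a) {k : ℕ}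
    (hE : E ≤ 2 * r * k) (hM : (a - r) * k ≤ 2 * M) : E ≤ 4 * r := by
  obtain rfl : b = n - a := by linarith
  -- Each covering vertex gains at most `2r` in `E` but costs `(a - r)/2` in `M`; three of them
  -- already lose more than the available `n/2`.
  have hk : k ≤ 2 := by
    by_contra! hk
    have hk' : (3 : ℝ) ≤ k := by exact_mod_cast hk
    have h5 : 0 ≤ a - 5 * r := by nlinarith
    have h6 : 3 * (a - 5 * r) ≤ k * (a - 5 * r) := mul_le_mul_of_nonneg_right hk' h5
    nlinarith [sq_nonneg (2 * a - n + 3 / 2), sq_nonneg (r - 11 / 8)]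
  have hk' : (k : ℝ) ≤ 2 := by exact_mod_cast hk
  nlinarith

/-- Since `b ≤ 2n/3`, a smaller `X` gives `l < 2n(r² + r + 11/3) + 4r`. The hypothesis on `n` gives
`n²/4 ≥ 2n(r² + r + 4)`, and the spare `n/6` absorbs `4r` because `n ≥ 24r`. -/
lemma card_le_weight_sum (hr : 1 ≤ r) (hn : 8 * (r ^ 2 + r + 4) ≤ n) (hab : a + b = n)
    (hl : n ^ 2 - 2 * n < 4 * l) (ha : n / 3 ≤ a) (hE : E ≤ 4 * r) {X : ℝ} (hX : 0 ≤ X)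
    (h : l ≤ b * X + E) : 3 * r ^ 2 + 3 * r + 11 ≤ X := by
  by_contra! hlt
  have hn0 : 24 * r ≤ n := by nlinarith [sq_nonneg (r - 1)]
  have h1 : b * X ≤ 2 * n / 3 * X := mul_le_mul_of_nonneg_right (by linarith) hX
  have h2 : 2 * n / 3 * X ≤ 2 * n / 3 * (3 * r ^ 2 + 3 * r + 11) :=
    mul_le_mul_of_nonneg_left hlt.le (by linarith)
  have h3 : 0 ≤ n * (n - 8 * (r ^ 2 + r + 4)) := mul_nonneg (by linarith) (by linarith)
  nlinarith

variable (hr : 1 ≤ r) (hn : 8 * (r ^ 2 + r + 4) ≤ n) (hab : a + b = n)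
  (hM : M < n / 2 + 4 * r - (a - b) ^ 2 / 4)
include hr hn hab hM

lemma not_disjoint_edges : ¬ 2 * (b - r) ≤ M := fun h => by
  obtain rfl : a = n - b := by linarith
  nlinarith [sq_nonneg (2 * b - n + 2), sq_nonneg (r - 1)]

lemma not_triangle : ¬ 3 * (b - r) ≤ 2 * M := fun h => by
  obtain rfl : a = n - b := by linarith
  nlinarith [sq_nonneg (2 * b - n + 3 / 2), sq_nonneg (r - 1)]

lemma not_crossing_edges : ¬ (b - r) + (a - r) - 4 ≤ M := fun h => by
  nlinarith [sq_nonneg (a - b), sq_nonneg (r - 1)]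

end Numerics

/-! ### The near-bipartition and the final comparison. -/

section Main

variable {V : Type*} [Fintype V] {G : SimpleGraph V} {r : ℕ} {x : V → ℝ} {μ : ℝ}

/-- A non-bipartite graph without `B_{r+1}` and with large spectral radius becomes bipartite after
the deletion of some vertex `v`. -/
lemma exists_almost_bipartition (hr : 1 ≤ r) (hn : 8 * (r ^ 2 + r + 4) ≤ Fintype.card V)
    (hbip : ¬ G.IsBipartite)
    (hcod : ∀ w z, G.Adj w z → (Finset.univ.filter fun y => G.Adj w y ∧ G.Adj z y).card ≤ r)
    (hx0 : ∀ w, 0 ≤ x w) (hx1 : ∀ w, x w ≤ 1) {u : V} (hu : x u = 1) (hμ : 0 < μ)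
    (hx : ∀ w, ∑ z with G.Adj w z, x z = μ * x w)
    (hlarge : (Fintype.card V : ℝ) ^ 2 - 2 * Fintype.card V < 4 * μ ^ 2) :
    ∃ (v : V) (S T : Finset V), Disjoint S T ∧ v ∉ S ∧ v ∉ T ∧ (∀ w, w = v ∨ w ∈ S ∨ w ∈ T) ∧
      r ≤ S.card ∧ r ≤ T.card ∧
      (∀ w ∈ S, ∀ z ∈ S, ¬ G.Adj w z) ∧ (∀ w ∈ T, ∀ z ∈ T, ¬ G.Adj w z) ∧
      (∃ s ∈ S, G.Adj v s) ∧ (∃ t ∈ T, G.Adj v t) ∧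
      (∀ s ∈ S, G.Adj v s → x v ≤ x s) ∧
      (r < (S.filter (G.Adj v)).card → ∀ t ∈ T, G.Adj v t → x v ≤ x t) := by
  set n : ℝ := (Fintype.card V : ℝ) with hndef
  have hr' : (1 : ℝ) ≤ r := by exact_mod_cast hr
  have hn' : 8 * ((r : ℝ) ^ 2 + r + 4) ≤ n := by
    rw [hndef]; exact_mod_cast hn
  set B : Finset V := Finset.univ.filter (G.Adj u) with hB
  set A : Finset V := Finset.univ.filter fun w => ¬ G.Adj u w with hA
  have hdisj : Disjoint A B := (Finset.disjoint_filter_filter_not _ _ _).symm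
  have hcover : ∀ w, w ∈ A ∨ w ∈ B := fun w => by
    simp only [hA, hB, Finset.mem_filter, Finset.mem_univ, true_and]
    tauto
  have hab : (A.card + B.card : ℝ) = n := by
    rw [hndef, ← Finset.card_univ,
      ← Finset.card_filter_add_card_filter_not (s := Finset.univ) (G.Adj u)]
    push_cast
    ring
  have hdegB : ∀ w ∈ B, G.degIn B w ≤ r := by
    intro w hw
    have h := hcod u w (Finset.mem_filter.1 hw).2
    rw [degIn, hB, Finset.filter_filter]
    exact_mod_cast h
  set M := ∑ w ∈ B, ((A.card : ℝ) - G.degIn A w) with hMdef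
  have hMA : M = ∑ w ∈ A, ((B.card : ℝ) - G.degIn B w) := G.sum_card_sub_degIn_comm B A
  have hM0 : 0 ≤ M := Finset.sum_nonneg fun w _ => sub_nonneg.2 (G.degIn_le_card A w)
  set E := ∑ w ∈ B, G.degIn B w with hE
  have hsumB : ∑ w ∈ B, x w = μ := by rw [hB, hx, hu, mul_one]
  -- Weighted walks of length two starting at `u`, where `x u = 1`.
  have hsq : μ ^ 2 = ∑ w ∈ B, (∑ z ∈ A with G.Adj w z, x z + ∑ z ∈ B with G.Adj w z, x z) := by
    rw [sq]
    nth_rewrite 2 [← hsumB]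
    rw [Finset.mul_sum]
    exact Finset.sum_congr rfl fun w _ => by rw [← hx, sum_adj_eq_add hdisj hcover]
  have hwalk : μ ^ 2 ≤ A.card * B.card - M + E := by
    have h1 : μ ^ 2 ≤ ∑ w ∈ B, (G.degIn A w + G.degIn B w) := by
      rw [hsq]
      exact Finset.sum_le_sum fun w _ =>
        add_le_add (sum_filter_adj_le_degIn hx1 A w) (sum_filter_adj_le_degIn hx1 B w)
    rw [Finset.sum_add_distrib] at h1
    rw [hMdef, Finset.sum_sub_distrib, Finset.sum_const, nsmul_eq_mul]
    linarith
  have hwalk' : μ ^ 2 ≤ B.card * ∑ w ∈ A, x w + E := by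
    rw [hsq, Finset.sum_add_distrib, ← nsmul_eq_mul, ← Finset.sum_const]
    refine add_le_add (Finset.sum_le_sum fun w _ => ?_)
      (Finset.sum_le_sum fun w _ => sum_filter_adj_le_degIn hx1 B w)
    exact Finset.sum_le_sum_of_subset_of_nonneg (Finset.filter_subset _ _) fun z _ _ => hx0 z
  have hErb : E ≤ B.card * r := by
    rw [← nsmul_eq_mul]
    exact Finset.sum_le_card_nsmul _ _ _ hdegB
  obtain ⟨ha, hb⟩ := third_le_card_of_walks hr' hn' hab hlarge
    (show μ ^ 2 ≤ B.card * (A.card + r) by linarith)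
  have hE4 : E ≤ 4 * r := inner_degree_sum_le hr' hn' hab hlarge hwalk ha
    (sum_degIn_le_mul_card (Q := A) hcod hdegB) (mul_card_le_sum_card_sub_degIn _)
  have hM1 : M < n / 2 + E - (A.card - B.card : ℝ) ^ 2 / 4 := by
    rw [← hab] at hlarge ⊢
    linarith
  have hM2 : M < n / 2 + 4 * r - (A.card - B.card : ℝ) ^ 2 / 4 := by linarith
  have hM2' : M < n / 2 + 4 * r - (B.card - A.card : ℝ) ^ 2 / 4 := by linarith
  have hba : (B.card + A.card : ℝ) = n := by linarith
  have hXA : 3 * (r : ℝ) ^ 2 + 3 * r + 11 ≤ ∑ w ∈ A, x w :=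
    card_le_weight_sum hr' hn' hab hlarge ha hE4 (Finset.sum_nonneg fun w _ => hx0 w) hwalk'
  have hXB : 3 * (r : ℝ) ^ 2 + 3 * r + 11 ≤ ∑ w ∈ B, x w := by
    rw [hsumB]
    by_contra! hlt
    nlinarith
  by_cases hBB : ∃ w ∈ B, ∃ z ∈ B, G.Adj w z
  · obtain ⟨w₀, hw₀, z₀, hz₀, h₀⟩ := hBB
    have hAA : ∀ w ∈ A, ∀ z ∈ A, ¬ G.Adj w z := fun w hw z hz hwz =>
      not_crossing_edges hr' hn' hab hM2
        (hMA ▸ card_add_card_sub_le_of_edges hcod hw hz hw₀ hz₀ hwz h₀)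
    obtain ⟨v, hv, hvw, hstar⟩ := exists_star_center (G := G) (P := B)
      (fun w hw z hz w' hw' z' hz' h h' h1 h2 h3 h4 => not_disjoint_edges hr' hn' hba hM2'
        (card_sub_le_of_disjoint_edges hcod hw hz hw' hz' h h' h1 h2 h3 h4))
      (fun w hw z hz y hy h1 h2 h3 => not_triangle hr' hn' hba hM2'
        (card_sub_le_of_triangle hcod hw hz hy h1 h2 h3)) hw₀ hz₀ h₀
    obtain ⟨v, hv, hvw, hstar, hweight⟩ := exists_star_center_of_weight x hv hvw hstar
    refine exists_star_data hr hbip hcod hx0 hx1 hμ hx hdisj.symm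
      (fun w => (hcover w).symm) hba hAA hv hvw hstar hweight
      (Or.inr ⟨rfl, hdegB v hv⟩) (hM1.trans_le ?_) hXB hXA
    -- In a star the other vertices have total degree at most that of the centre.
    have hEle : E ≤ 2 * G.degIn B v := by
      have h1 : ∑ w ∈ B.erase v, G.degIn B w ≤ G.degIn B v := by
        calc ∑ w ∈ B.erase v, G.degIn B w
            ≤ ∑ w ∈ B.erase v, (if G.Adj v w then (1 : ℝ) else 0) := by
              refine Finset.sum_le_sum fun w hw => ?_
              rw [Finset.mem_erase] at hw
              have hsub : B.filter (G.Adj w) ⊆ if G.Adj v w then {v} else ∅ := by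
                intro z hz
                rw [Finset.mem_filter] at hz
                have hzv := (hstar w hw.2 z hz.1 hz.2).resolve_left hw.1
                subst hzv
                rw [if_pos hz.2.symm]
                exact Finset.mem_singleton_self _
              rw [degIn]
              have := Finset.card_le_card hsub
              split_ifs at this ⊢
              · rw [Finset.card_singleton] at this
                exact_mod_cast this
              · rw [Finset.card_empty] at this
                exact_mod_cast this
          _ ≤ ∑ w ∈ B, (if G.Adj v w then (1 : ℝ) else 0) :=
              Finset.sum_le_sum_of_subset_of_nonneg (Finset.erase_subset _ _)
                fun w _ _ => by split_ifs <;> norm_num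
          _ = _ := (G.degIn_eq_sum B v).symm
      rw [hE, ← Finset.sum_erase_add B _ hv]
      linarith
    linarith
  · push Not at hBB
    have hE0 : E = 0 := by
      refine Finset.sum_eq_zero fun w hw => ?_
      rw [degIn, Finset.filter_false_of_mem (hBB w hw)]
      simp
    by_cases hAA : ∃ w ∈ A, ∃ z ∈ A, G.Adj w z
    · obtain ⟨w₀, hw₀, z₀, hz₀, h₀⟩ := hAA
      obtain ⟨v, hv, hvw, hstar⟩ := exists_star_center (G := G) (P := A)
        (fun w hw z hz w' hw' z' hz' h h' h1 h2 h3 h4 => not_disjoint_edges hr' hn' hab hM2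
          (hMA ▸ card_sub_le_of_disjoint_edges hcod hw hz hw' hz' h h' h1 h2 h3 h4))
        (fun w hw z hz y hy h1 h2 h3 => not_triangle hr' hn' hab hM2
          (hMA ▸ card_sub_le_of_triangle hcod hw hz hy h1 h2 h3)) hw₀ hz₀ h₀
      obtain ⟨v, hv, hvw, hstar, hweight⟩ := exists_star_center_of_weight x hv hvw hstar
      exact exists_star_data hr hbip hcod hx0 hx1 hμ hx hdisj hcover hab hBB hv hvw hstar
        hweight (Or.inl hE0) (hMA ▸ hM1) hXA hXB
    · push Not at hAA
      exact absurd (isBipartite_of_partition hcover hAA hBB) hbip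

lemma floor_half_eq {n : ℕ} (hn : 1 ≤ n) : ⌊((n : ℚ) - 1) / 2⌋₊ = (n - 1) / 2 := by
  rw [show ((n : ℚ) - 1) / 2 = ((n - 1 : ℕ) : ℚ) / (2 : ℕ) by push_cast [hn]; rfl,
    Nat.floor_div_eq_div]

lemma ceil_half_eq {n : ℕ} (hn : 2 ≤ n) : ⌈((n : ℚ) - 1) / 2⌉₊ = n / 2 := by
  have h : ((n - 1 : ℕ) : ℚ) = (n : ℚ) - 1 := by push_cast [show 1 ≤ n by omega]; rfl
  rw [← h, Nat.ceil_eq_iff (by omega)]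
  constructor
  · rw [lt_div_iff₀ two_pos]
    have : (n / 2 - 1) * 2 < n - 1 := by omega
    exact_mod_cast this
  · rw [div_le_iff₀ two_pos]
    have : n - 1 ≤ n / 2 * 2 := by omega
    exact_mod_cast this

lemma mul_lt_of_not_balanced {s t n : ℕ} (h : s + t + 1 = n)
    (hne : ¬ (s = (n - 1) / 2 ∧ t = n / 2 ∨ t = (n - 1) / 2 ∧ s = n / 2)) :
    s * t < ((n - 1) / 2) * (n / 2) := by
  obtain ⟨k, hk | hk⟩ := Nat.even_or_odd' n
  · have e1 : (n - 1) / 2 = k - 1 := by omega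
    have e2 : n / 2 = k := by omega
    rw [e1, e2] at hne ⊢
    have e3 : s + 1 < k ∨ k < s := by omega
    have e4 : (t : ℤ) = 2 * k - 1 - s := by omega
    zify [show 1 ≤ k by omega] at e3 ⊢
    rw [e4]
    have : 0 < ((k : ℤ) - s) * (k - 1 - s) := by
      rcases e3 with e3 | e3
      · exact mul_pos (by omega) (by omega)
      · exact mul_pos_of_neg_of_neg (by omega) (by omega)
    linarith
  · have e1 : (n - 1) / 2 = k := by omega
    have e2 : n / 2 = k := by omega
    rw [e1, e2] at hne ⊢
    have e4 : (t : ℤ) = 2 * k - s := by omega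
    have e3 : (k : ℤ) - s ≠ 0 := by omega
    zify
    rw [e4]
    have := pow_pos (abs_pos.2 e3) 2
    rw [sq_abs] at this
    linarith

/-- Source of the threshold `n² - 2n < 4ρ²`; equality holds for even `n`. -/
lemma mul_sub_two_le_balanced {n : ℕ} (hn : 2 ≤ n) :
    n * (n - 2) ≤ 4 * (((n - 1) / 2) * (n / 2)) := by
  obtain ⟨k, hk | hk⟩ := Nat.even_or_odd' n
  · have e1 : (n - 1) / 2 = k - 1 := by omega
    have e2 : n / 2 = k := by omega
    have e3 : n - 2 = 2 * (k - 1) := by omega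
    rw [e1, e2, e3, hk]
    exact le_of_eq (by ring)
  · have e1 : (n - 1) / 2 = k := by omega
    have e2 : n / 2 = k := by omega
    have e3 : n - 2 = 2 * k - 1 := by omega
    rw [e1, e2, e3, hk]
    zify [show 1 ≤ 2 * k by omega]
    linarith

/-- A non-bipartite `B_{r+1}`-free graph whose spectral radius is at least that of the balanced
graph `K_{s,t}^{r,r}` is isomorphic to it. -/
lemma nonempty_iso_of_rho_le {n : ℕ} (hr : 1 ≤ r) (hn : 8 * (r ^ 2 + r + 4) ≤ n)
    (hV : Fintype.card V = n) (hbip : ¬ G.IsBipartite) (hfree : (book (r + 1)).Free G)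
    (hle : (bipartiteAddVertex ((n - 1) / 2) (n / 2) r r).rho ≤ G.rho) :
    Nonempty (G ≃g bipartiteAddVertex ((n - 1) / 2) (n / 2) r r) := by
  have hr' : (1 : ℝ) ≤ r := by exact_mod_cast hr
  have hrr : 2 * r + 2 ≤ n := by nlinarith
  obtain ⟨v', S', T', P', Q', h', hS', hT'⟩ := exists_isConeData (V := V) (r := r)
    (s := (n - 1) / 2) (t := n / 2) (by omega) (by omega) (by omega)
  obtain ⟨iso'⟩ := h'.nonempty_iso
  rw [hS', hT'] at iso'
  rw [← rho_congr iso'] at hle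
  have hpos := h'.rho_pos hr
  have hsq := (h'.rho_equation hr).1
  have hμ : 0 < G.rho := hpos.trans_le hle
  have hlarge : (n : ℝ) ^ 2 - 2 * n < 4 * G.rho ^ 2 := by
    have h1 := mul_sub_two_le_balanced (n := n) (by omega)
    have h2 : ((n * (n - 2) : ℕ) : ℝ) ≤ 4 * (S'.card * T'.card) := by
      rw [hS', hT']; exact_mod_cast h1
    rw [Nat.cast_mul, Nat.cast_sub (by omega)] at h2
    have h3 : (coneGraph v' S' T' P' Q').rho ^ 2 ≤ G.rho ^ 2 := by gcongr
    push_cast at h2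
    nlinarith
  have hcod := card_common_nbrs_le_of_book_free hfree
  have : Nonempty V := ⟨v'⟩
  obtain ⟨x, u, hx0, hu, hx1, hx⟩ := G.exists_nonneg_eigenvector
  obtain ⟨v, S, T, hdisj, hvS, hvT, hcover, hSr, hTr, hSS, hTT, hnS, hnT, hxS, hxT⟩ :=
    exists_almost_bipartition hr (by rw [hV]; exact hn) hbip hcod hx0 hx1 hu hμ hx
      (by rw [hV]; exact hlarge)
  obtain ⟨P, Q, hc, hquad, hrow⟩ := exists_coneGraph_quadratic_le hr G hdisj hvS hvT hcover hSr hTr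
    hSS hTT hcod hnS hnT hx0 hxS hxT
  have hquadG : ∑ w, x w * ∑ z with G.Adj w z, x z = G.rho * ∑ w, x w ^ 2 := by
    rw [Finset.mul_sum]
    exact Finset.sum_congr rfl fun w _ => by rw [hx]; ring
  have hxx : 0 < ∑ w, x w ^ 2 :=
    Finset.sum_pos' (fun w _ => sq_nonneg _) ⟨u, Finset.mem_univ _, by rw [hu]; norm_num⟩
  have hGH : G.rho ≤ (coneGraph v S T P Q).rho := by
    refine le_of_mul_le_mul_right ?_ hxx
    rw [← hquadG]
    exact hquad.trans (sum_mul_sum_adj_le_rho _ x)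
  have hcards := hc.card_add_card
  rw [hV] at hcards
  have hbal : S.card = (n - 1) / 2 ∧ T.card = n / 2 ∨ T.card = (n - 1) / 2 ∧ S.card = n / 2 := by
    by_contra hne
    have hlt : S.card * T.card < S'.card * T'.card := by
      rw [hS', hT']
      exact mul_lt_of_not_balanced hcards hne
    have h2r : 2 * r ≤ S'.card * T'.card := by
      rw [hS', hT']
      exact Nat.mul_le_mul (by omega) (by omega)
    exact absurd (hle.trans hGH) (not_le.2 (hc.rho_lt_rho hr h' hlt h2r))
  have isoH : Nonempty (coneGraph v S T P Q ≃g bipartiteAddVertex ((n - 1) / 2) (n / 2) r r) := by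
    rcases hbal with ⟨h1, h2⟩ | ⟨h1, h2⟩
    · have := hc.nonempty_iso
      rwa [h1, h2] at this
    · have := hc.symm.nonempty_iso
      rwa [h1, h2, IsConeData.coneGraph_comm] at this
  have hrho : (coneGraph v S T P Q).rho ≤ G.rho := by
    obtain ⟨iso⟩ := isoH
    rwa [rho_congr (iso.trans iso'.symm)]
  suffices h : G = coneGraph v S T P Q by rw [h]; exact isoH
  by_contra hne
  -- With equal radii, `x` attains the Rayleigh maximum of the cone graph, so it is an eigenvector
  -- there and hence positive.
  have hxH := (coneGraph v S T P Q).sum_adj_eq_of_rho_le x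
    ((mul_le_mul_of_nonneg_right hrho hxx.le).trans (hquadG.symm.le.trans hquad))
  have hxpos := (hc.eigenvalue_equation hr (hc.rho_pos hr) hxH hx0
    (fun h0 => by simp [h0] at hu)).1
  obtain ⟨w, hw, z, hz, hz'⟩ := hrow hne
  have hlt : ∑ z with G.Adj w z, x z < ∑ z with (coneGraph v S T P Q).Adj w z, x z := by
    refine Finset.sum_lt_sum_of_subset (i := z) (fun y hy => ?_) (by simpa using hz)
      (by simpa using hz') (hxpos z) fun y _ _ => hx0 y
    simp only [Finset.mem_filter, Finset.mem_univ, true_and] at hy ⊢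
    exact hw y hy
  rw [hx, hxH, le_antisymm hGH hrho] at hlt
  exact lt_irrefl _ hlt

end Main

end SimpleGraph

theorem theorem1p3 (r n : ℕ) (hr : 1 ≤ r) (hn : 8 * (r ^ 2 + r + 4) ≤ n)
    {V : Type*} [Fintype V] (hV : Fintype.card V = n) (G : SimpleGraph V)
    (hbip : ¬ G.IsBipartite) (hfree : (SimpleGraph.book (r + 1)).Free G) :
    G.rho ≤ (SimpleGraph.bipartiteAddVertex
        ⌊((n : ℚ) - 1) / 2⌋₊ ⌈((n : ℚ) - 1) / 2⌉₊ r r).rho ∧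
      (G.rho = (SimpleGraph.bipartiteAddVertex
          ⌊((n : ℚ) - 1) / 2⌋₊ ⌈((n : ℚ) - 1) / 2⌉₊ r r).rho ↔
        Nonempty (G ≃g SimpleGraph.bipartiteAddVertex
          ⌊((n : ℚ) - 1) / 2⌋₊ ⌈((n : ℚ) - 1) / 2⌉₊ r r)) := by
  have hn2 : 2 ≤ n := by omega
  rw [SimpleGraph.floor_half_eq (by omega), SimpleGraph.ceil_half_eq hn2]
  have key := SimpleGraph.nonempty_iso_of_rho_le hr hn hV hbip hfree
  refine ⟨?_, fun h => key h.ge, fun ⟨e⟩ => SimpleGraph.rho_congr e⟩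
  by_contra! hlt
  obtain ⟨e⟩ := key hlt.le
  exact hlt.ne' (SimpleGraph.rho_congr e)
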